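/- Let $D$ be a locally compact second countable Hausdorff space, let $\partial$ be a cemetery point adjoined to $D$ by one-point compactification (isolated if $D$ is compact), and let $X(t)$ be a Hunt process on $D$ with lifetime $\zeta$: a normal strong Markov process with càdlàg paths in $D\cup\{\partial\}$, absorbed at $\partial$ from the time $\zeta\in[0,\infty]$ on, and quasi-left-continuous. Let $m$ be a finite Borel measure on $D$ such that $X(t)$ is self-dual with respect to $m$, that is, the transition operators $P_t f(x)=\mathbb E^x f(X(t))$ (with $f(\partial)=0$) are self-adjoint on $L^2(m)$. Consider the Fleming--Viot system of two particles driven by $X(t)$. The two particles start from an initial configuration in $D\times D$ and evolve as independent copies $X_1,Y_1$ of $X(t)$ up to the first branching time $\tau_1=\min\{\zeta^{X_1},\zeta^{Y_1}\}$. Let $Z_1$ be the position at that time of the surviving particle, that is, $Z_1=X_1(\zeta^{Y_1})$ if $\zeta^{Y_1}<\zeta^{X_1}$, $Z_1=Y_1(\zeta^{X_1})$ if $\zeta^{X_1}<\zeta^{Y_1}$, and $Z_1=\partial$ if $\zeta^{X_1}=\zeta^{Y_1}$. Recursively, given the past, let $X_{n+1},Y_{n+1}$ be independent copies of $X(t)$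 both started at $Z_n$, let $\tau_{n+1}=\tau_n+\min\{\zeta^{X_{n+1}},\zeta^{Y_{n+1}}\}$, and define $Z_{n+1}$ from $(X_{n+1},Y_{n+1})$ in the same way (a particle started at $\partial$ stays there and has lifetime $0$). If both particles start from the same point, denote this point by $Z_0$. Write $\bar{\mathbb P}^\mu=\int\bar{\mathbb P}^{x,y}\,\mu(dx,dy)$ for the law of the system with initial configuration distributed according to a finite measure $\mu$ on $D\times D$ (a finite measure with the same total mass as $\mu$), and let $\delta$ be the image of $m$ under $x\mapsto(x,x)$. Assume that $\tau_n<\infty$ for all $n$, $\bar{\mathbb P}^\delta$-almost surely. Then: 1. $(Z_n)$ is a time-homogeneous Markov chain on $D\cup\{\partial\}$ with transition kernel $Q(z,B)=\bar{\mathbb P}^{z,z}(Z_1\in B)$: the sequence $(Z_n)_{n\ge1}$ is so under $\bar{\mathbb P}^\mu$ for every finite measure $\mu$ on $D\times D$, and $(Z_n)_{n\ge0}$ is so whenever $\mu$ is the image of a finite measure on $D$ under $x\mapsto(x,x)$. 2. The chain is conservative: for almost every initial configuration it never leaves $D$. Namely, $Z_n\in D$ for all $n\ge0$ holds $\bar{\mathbb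 P}^\delta$-almost surely, and $Z_n\in D$ for all $n\ge1$ holds $\bar{\mathbb P}^{m\times m}$-almost surely. 3. $m$ is a stationary measure for the chain: $m$ (viewed as a measure on $D\cup\{\partial\}$) satisfies $\int Q(x,\cdot)\,m(dx)=m$, and under $\bar{\mathbb P}^\delta$ every $Z_n$, $n\ge0$, has distribution $m$. -/

import Mathlib

open MeasureTheory ProbabilityTheory Filter Topology Set
open scoped NNReal ENNReal

/-! ### The state space with a cemetery point -/

section StateSpace

variable {D : Type*} [TopologicalSpace D]

/-- `OnePoint D` is the state space `D` with the cemetery `∞` adjoined (at infinity, or as an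
isolated point if `D` is compact); it carries its Borel σ-algebra. -/
instance OnePoint.instMeasurableSpaceBorel : MeasurableSpace (OnePoint D) := borel _

instance OnePoint.instBorelSpaceBorel : BorelSpace (OnePoint D) := ⟨rfl⟩

theorem OnePoint.measurable_coe_borel [MeasurableSpace D] [BorelSpace D] :
    Measurable ((↑) : D → OnePoint D) :=
  OnePoint.continuous_coe.measurable

instance OnePoint.instSecondCountable [T2Space D] [LocallyCompactSpace D]
    [SecondCountableTopology D] : SecondCountableTopology (OnePoint D) := by
  let K : CompactExhaustion D := default
  let b : Set (Set (OnePoint D)) :=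
    ((fun s : Set D => ((↑) : D → OnePoint D) '' s) '' TopologicalSpace.countableBasis D) ∪
      range (fun n => (((↑) : D → OnePoint D) '' K n)ᶜ)
  have hb : b.Countable :=
    ((TopologicalSpace.countable_countableBasis D).image _).union (countable_range _)
  refine TopologicalSpace.IsTopologicalBasis.secondCountableTopology (b := b) ?_ hb
  refine TopologicalSpace.isTopologicalBasis_of_isOpen_of_nhds ?_ ?_
  · rintro u (⟨s, hs, rfl⟩ | ⟨n, rfl⟩)
    · exact OnePoint.isOpenEmbedding_coe.isOpenMap _ (TopologicalSpace.isOpen_of_mem_countableBasis hs)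
    · exact OnePoint.isOpen_compl_image_coe.2 ⟨(K.isCompact n).isClosed, K.isCompact n⟩
  · intro a u ha hu
    induction a using OnePoint.rec with
    | infty =>
      obtain ⟨hc, hk⟩ := (OnePoint.isOpen_iff_of_mem ha).1 hu
      obtain ⟨n, hn⟩ := K.exists_superset_of_isCompact hk
      refine ⟨_, Or.inr ⟨n, rfl⟩, OnePoint.infty_notMem_image_coe, ?_⟩
      intro z hz
      induction z using OnePoint.rec with
      | infty => exact ha
      | coe z =>
        by_contra h
        exact hz ⟨z, hn h, rfl⟩
    | coe a =>
      obtain ⟨s, hs, has, hsu⟩ :=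
        (TopologicalSpace.isBasis_countableBasis D).exists_subset_of_mem_open
          (show a ∈ ((↑) : D → OnePoint D) ⁻¹' u from ha)
          (hu.preimage OnePoint.continuous_coe)
      exact ⟨_, Or.inl ⟨s, hs, rfl⟩, ⟨a, has, rfl⟩, image_subset_iff.2 hsu⟩

end StateSpace

/-! ### Hunt processes -/

/-- A Hunt process on a locally compact second countable Hausdorff space `D`, realized on the
measurable space `Ω`: a normal strong Markov family `(P x)`, `x ∈ D ∪ {∞}`, with càdlàg paths in
`D ∪ {∞}` absorbed at the cemetery `∞`, and quasi-left-continuous. Stopping times are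
taken with respect to the right-continuous filtration `(⨅ s > t, σ(X u, u ≤ s))`. -/
structure HuntProcess (D Ω : Type*) [TopologicalSpace D] [T2Space D] [LocallyCompactSpace D]
    [SecondCountableTopology D] [MeasurableSpace Ω] where
  /-- The position at time `t`; the value `∞` means that the particle is dead. -/
  X : ℝ≥0 → Ω → OnePoint D
  /-- The law of the process started at a given point. -/
  P : Kernel (OnePoint D) Ω
  isMarkovKernel_P : IsMarkovKernel P
  measurable_X : ∀ t, Measurable (X t)
  start : ∀ x, ∀ᵐ ω ∂(P x), X 0 ω = x
  rightCont : ∀ ω t, ContinuousWithinAt (fun s => X s ω) (Ici t) t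
  leftLim : ∀ ω t, ∃ l, Tendsto (fun s => X s ω) (𝓝[<] t) (𝓝 l)
  absorbed : ∀ ω s t, s ≤ t → X s ω = OnePoint.infty → X t ω = OnePoint.infty
  strongMarkov : ∀ (T : Ω → WithTop ℝ≥0)
    (hT : IsStoppingTime
      (Filtration.natural X fun t => (measurable_X t).stronglyMeasurable).rightCont T)
    (x : OnePoint D) (t : ℝ≥0) (A : Set Ω) (B : Set (OnePoint D)),
    MeasurableSet[hT.measurableSpace] A → MeasurableSet B →
      P x (A ∩ {ω | T ω ≠ ⊤} ∩ {ω | X ((T ω).untopD 0 + t) ω ∈ B}) =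
        ∫⁻ ω in A ∩ {ω | T ω ≠ ⊤}, P (X ((T ω).untopD 0) ω) {ω' | X t ω' ∈ B} ∂(P x)
  quasiLeftCont : ∀ T : ℕ → Ω → WithTop ℝ≥0,
    (∀ n, IsStoppingTime
      (Filtration.natural X fun t => (measurable_X t).stronglyMeasurable).rightCont (T n)) →
    Monotone T → ∀ x, ∀ᵐ ω ∂(P x), ∀ t : ℝ≥0,
      IsLUB (range fun n => T n ω) (t : WithTop ℝ≥0) →
        Tendsto (fun n => X ((T n ω).untopD 0) ω) atTop (𝓝 (X t ω))

/-- `Z` is a time-homogeneous Markov chain with transition kernel `Q` under the (finite, not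
necessarily normalized) measure `μ`: the conditional law of `Z (n + 1)` given `Z 0, …, Z n` is
`Q (Z n)`. -/
def IsMarkovChain {Ω S : Type*} [MeasurableSpace Ω] [MeasurableSpace S] (μ : Measure Ω)
    (Z : ℕ → Ω → S) (Q : Kernel S S) : Prop :=
  (∀ n, Measurable (Z n)) ∧
    ∀ (n : ℕ) (A : Set (Finset.Iic n → S)) (B : Set S), MeasurableSet A → MeasurableSet B →
      μ ({ω | (fun i : Finset.Iic n => Z i ω) ∈ A} ∩ {ω | Z (n + 1) ω ∈ B}) =
        ∫⁻ ω in {ω | (fun i : Finset.Iic n => Z i ω) ∈ A}, Q (Z n ω) B ∂μ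

namespace HuntProcess

variable {D Ω : Type*} [TopologicalSpace D] [T2Space D] [LocallyCompactSpace D]
  [SecondCountableTopology D] [MeasurableSpace Ω] (H : HuntProcess D Ω)

instance : IsMarkovKernel H.P := H.isMarkovKernel_P

/-- The transition operator `P_t f (x) = E^x f(X_t)`, where `f(∞) = 0`. -/
noncomputable def transitionOp (t : ℝ≥0) (f : D → ℝ) (x : D) : ℝ :=
  ∫ ω, (H.X t ω).elim 0 f ∂(H.P (x : OnePoint D))

/-- Self-duality: the transition operators are self-adjoint on `L²(m)`. -/
def IsSelfDual [MeasurableSpace D] (m : Measure D) : Prop :=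
  ∀ (t : ℝ≥0) (f g : D → ℝ), Measurable f → Measurable g → MemLp f 2 m → MemLp g 2 m →
    ∫ x, H.transitionOp t f x * g x ∂m = ∫ x, f x * H.transitionOp t g x ∂m

/-- The lifetime `ζ`. -/
noncomputable def lifetime (ω : Ω) : ℝ≥0∞ :=
  ⨅ (t : ℝ≥0) (_ : H.X t ω = OnePoint.infty), (t : ℝ≥0∞)

/-- For a pair of paths, the time `σ = min (ζ^X, ζ^Y)` of the first death. -/
noncomputable def firstDeath (p : Ω × Ω) : ℝ≥0∞ :=
  min (H.lifetime p.1) (H.lifetime p.2)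

/-- For a pair of paths, the position of the surviving particle at the first death, and `∞` if
there is no survivor because both lifetimes agree (finite or infinite). -/
noncomputable def survivor (p : Ω × Ω) : OnePoint D :=
  open Classical in
  if H.lifetime p.2 < H.lifetime p.1 then H.X (H.lifetime p.2).toNNReal p.1
  else if H.lifetime p.1 < H.lifetime p.2 then H.X (H.lifetime p.1).toNNReal p.2
  else OnePoint.infty

theorem measurable_lifetime : Measurable H.lifetime := by
  refine measurable_of_Iio fun c => ?_
  have h : H.lifetime ⁻¹' Iio c =
      ⋃ (k : ℕ) (_ : (TopologicalSpace.denseSeq ℝ≥0 k : ℝ≥0∞) < c),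
        H.X (TopologicalSpace.denseSeq ℝ≥0 k) ⁻¹' {OnePoint.infty} := by
    ext ω
    simp only [lifetime, mem_preimage, mem_Iio, iInf_lt_iff, mem_iUnion, mem_singleton_iff,
      exists_prop]
    constructor
    · rintro ⟨t, ht, htc⟩
      obtain ⟨u, htu, huc⟩ := ENNReal.lt_iff_exists_nnreal_btwn.1 htc
      obtain ⟨k, hk⟩ := (TopologicalSpace.denseRange_denseSeq ℝ≥0).exists_mem_open isOpen_Ioo
        (nonempty_Ioo.2 (ENNReal.coe_lt_coe.1 htu))
      exact ⟨k, (ENNReal.coe_lt_coe.2 hk.2).trans huc, H.absorbed ω t _ hk.1.le ht⟩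
    · rintro ⟨k, hkc, hk⟩
      exact ⟨_, hk, hkc⟩
  rw [h]
  exact MeasurableSet.iUnion fun q => MeasurableSet.iUnion fun _ =>
    H.measurable_X _ (measurableSet_singleton _)

/-- The position at a measurable random time is measurable. -/
theorem measurable_X_comp {α : Type*} [MeasurableSpace α] {T : α → ℝ≥0} {g : α → Ω}
    (hT : Measurable T) (hg : Measurable g) : Measurable fun a => H.X (T a) (g a) := by
  have key : ∀ (e : ℕ → ℝ≥0) (N : α → ℕ), Measurable N →
      Measurable fun a => H.X (e (N a)) (g a) := by
    intro e N hN
    have h1 : Measurable fun p : ℕ × Ω => H.X (e p.1) p.2 :=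
      measurable_from_prod_countable_right fun k => H.measurable_X (e k)
    exact h1.comp (hN.prodMk hg)
  have hd : ∀ n : ℕ, Measurable fun a =>
      H.X (((⌊((n : ℝ≥0) + 1) * T a⌋₊ : ℝ≥0) + 1) / ((n : ℝ≥0) + 1)) (g a) := fun n =>
    key (fun k => ((k : ℝ≥0) + 1) / ((n : ℝ≥0) + 1)) (fun a => ⌊((n : ℝ≥0) + 1) * T a⌋₊)
      (Nat.measurable_floor.comp (hT.const_mul _))
  refine measurable_of_tendsto_metrizable hd (tendsto_pi_nhds.2 fun a => ?_)
  have hr : Tendsto (fun s => H.X s (g a)) (𝓝[≥] (T a)) (𝓝 (H.X (T a) (g a))) :=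
    H.rightCont (g a) (T a)
  have hlim : Tendsto (fun n : ℕ => ((⌊((n : ℝ≥0) + 1) * T a⌋₊ : ℝ≥0) + 1) / ((n : ℝ≥0) + 1))
      atTop (𝓝[≥] (T a)) := ?_
  · exact hr.comp hlim
  have hlow : ∀ n : ℕ, T a ≤ ((⌊((n : ℝ≥0) + 1) * T a⌋₊ : ℝ≥0) + 1) / ((n : ℝ≥0) + 1) := by
    intro n
    rw [le_div_iff₀ (by positivity), mul_comm]
    exact (Nat.lt_floor_add_one _).le
  refine tendsto_nhdsWithin_iff.2 ⟨?_, Eventually.of_forall hlow⟩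
  have hup : ∀ n : ℕ, ((⌊((n : ℝ≥0) + 1) * T a⌋₊ : ℝ≥0) + 1) / ((n : ℝ≥0) + 1) ≤
      T a + 1 / ((n : ℝ≥0) + 1) := by
    intro n
    rw [add_div]
    gcongr
    rw [div_le_iff₀ (by positivity), mul_comm]
    exact Nat.floor_le zero_le
  refine tendsto_of_tendsto_of_tendsto_of_le_of_le tendsto_const_nhds ?_ hlow hup
  simpa using tendsto_const_nhds.add (tendsto_one_div_add_atTop_nhds_zero_nat (𝕜 := ℝ≥0))

theorem measurable_survivor : Measurable H.survivor := by
  have h1 : Measurable fun p : Ω × Ω => H.lifetime p.1 := H.measurable_lifetime.comp measurable_fst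
  have h2 : Measurable fun p : Ω × Ω => H.lifetime p.2 := H.measurable_lifetime.comp measurable_snd
  exact Measurable.ite (measurableSet_lt h2 h1)
    (H.measurable_X_comp h2.ennreal_toNNReal measurable_fst)
    (Measurable.ite (measurableSet_lt h1 h2)
      (H.measurable_X_comp h1.ennreal_toNNReal measurable_snd) measurable_const)

/-- The law of two independent copies of the process, both started at the given point. -/
noncomputable def pairKernel : Kernel (OnePoint D) (Ω × Ω) :=
  (H.P ∥ₖ H.P).comap (fun z => (z, z)) (measurable_id.prodMk measurable_id)

instance : IsMarkovKernel H.pairKernel := by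
  unfold pairKernel; infer_instance

/-- The law of the excursion `n + 1` given the excursions `0, …, n`: two independent copies
started at the position of the survivor of the excursion `n`. -/
noncomputable def excursionKernel (n : ℕ) : Kernel (Finset.Iic n → Ω × Ω) (Ω × Ω) :=
  H.pairKernel.comap (fun w => H.survivor (w ⟨n, Finset.mem_Iic.2 le_rfl⟩))
    (H.measurable_survivor.comp (measurable_pi_apply _))

instance (n : ℕ) : IsMarkovKernel (H.excursionKernel n) := by
  unfold excursionKernel; infer_instance

/-- The law of the Fleming--Viot system of two particles, as the law of the sequence of its
excursions between branching times: under the measure `H.flemingViot μ`, excursion `0` consists of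
two independent copies of the process started at a pair of points sampled from `μ`, and each
following excursion of two independent copies both started at the survivor of the one before.
Excursion `n` is run until its first death. If `μ` is finite but not a probability measure, then
neither is `H.flemingViot μ`. -/
noncomputable def flemingViot [MeasurableSpace D] (μ : Measure (D × D)) :
    Measure (ℕ → Ω × Ω) :=
  Kernel.trajMeasure (X := fun _ => Ω × Ω)
    ((μ.map fun p => ((p.1 : OnePoint D), (p.2 : OnePoint D))).bind (H.P ∥ₖ H.P)) H.excursionKernel

/-- The branching time `τ_n`, the sum of the durations of the first `n` excursions. Excursions
that start in the cemetery (after two simultaneous deaths) have duration zero. -/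
noncomputable def branchingTime (n : ℕ) (w : ℕ → Ω × Ω) : ℝ≥0∞ :=
  ∑ k ∈ Finset.range n, H.firstDeath (w k)

/-- The position `Z_n` of the surviving particle at the branching time `τ_n`, `n ≥ 1`; `Z_0` is
the initial position of the first particle (of both particles, if they start from the same point).
-/
noncomputable def branchingPosition : ℕ → (ℕ → Ω × Ω) → OnePoint D
  | 0, w => H.X 0 (w 0).1
  | n + 1, w => H.survivor (w n)

/-- The transition kernel of the chain `Z_n` on `D ∪ {∞}`: from `z`, the law of the survivor's
position at the first death of two independent copies of the process, both started at `z`. -/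
noncomputable def branchingKernel : Kernel (OnePoint D) (OnePoint D) :=
  H.pairKernel.map H.survivor

end HuntProcess

/-- The measure `δ` on the diagonal of `D × D` with marginals `m`. -/
noncomputable def diagonalMeasure {D : Type*} [MeasurableSpace D] (m : Measure D) :
    Measure (D × D) :=
  m.map fun x => (x, x)

/-! ### Bounded functions and integration against a composition -/

/-! Everything rests on one identity: if `x` has distribution `m` and two independent copies start
at `x`, then the survivor's position at the first death again has distribution `m`. Write `c t = ∫
P_t f dm`. Self-duality and the semigroup law give `∫ P_s 1 · P_t f dm = c (s + t)`. The second
particle dies in `dt` with probability `-d(P_t 1)(x)`, and the first one then contributes `P_t f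
(x)`. So the integral of `f` at the first particle, at the death of the second, is formally `-∫
c'(2t) dt = (c 0 - c ∞) / 2 = (∫ f dm) / 2`. Here `c ∞ = 0` because lifetimes are finite: two
independent copies both live forever with probability `P^x(ζ = ∞) ^ 2`, which vanishes for almost
every `x` as `τ_1 < ∞`. Exchanging the two particles doubles the half into `∫ f dm`. With `f = 1`
there is no mass left for simultaneous deaths.

No differentiability of `c` is needed. The integral is the limit of Riemann sums in which the death
time is rounded up to a grid, which right-continuity of paths permits. Each sum collects every other
increment of `c`. The skipped increments differ from the collected ones by second differences, which
are inner products of increments of `P_t 1` and `P_t f` in `L²(m)`. The Cauchy–Schwarz inequality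
bounds their sum by the decrease of `∫ P_t 1 dm` over one mesh step, and this tends to `0`
(`IsSelfDual.sq_sum_second_difference_le`, `IsSelfDual.tendsto_riemann_sum`).

This yields `IsSelfDual.map_survivor_pairLawOf`, hence stationarity, and conservativeness from the
diagonal. From `m × m` it is enough that the law of `Z_1` is absolutely continuous with respect to
`m` (`IsSelfDual.map_survivor_absolutelyContinuous`), since the invariance of `m` passes this on to
every later `Z_n`. The Markov property holds because each excursion depends on the past only through
the last survivor. -/

theorem MeasureTheory.Measure.integral_bind_kernel {α β : Type*} [MeasurableSpace α]
    [MeasurableSpace β] {μ : Measure α} [IsFiniteMeasure μ] {κ : Kernel α β} [IsMarkovKernel κ]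
    {f : β → ℝ} (hf : Measurable f) {C : ℝ} (hC : ∀ x, |f x| ≤ C) :
    ∫ y, f y ∂(μ.bind κ) = ∫ x, ∫ y, f y ∂(κ x) ∂μ := by
  have h := Kernel.integral_comp (η := κ) (κ := Kernel.const Unit μ) (a := ()) (f := f)
    (Integrable.of_bound hf.aestronglyMeasurable C (ae_of_all _ hC))
  simpa [Kernel.comp_apply] using h

theorem OnePoint.measurableEmbedding_coe {D : Type*} [TopologicalSpace D] [MeasurableSpace D]
    [BorelSpace D] : MeasurableEmbedding ((↑) : D → OnePoint D) :=
  OnePoint.isOpenEmbedding_coe.measurableEmbedding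

theorem OnePoint.measurable_elim_zero {D : Type*} [TopologicalSpace D] [MeasurableSpace D]
    [BorelSpace D] {g : D → ℝ} (hg : Measurable g) :
    Measurable fun z : OnePoint D => z.elim 0 g := by
  have h : (fun z : OnePoint D => z.elim 0 g) =
      Function.extend ((↑) : D → OnePoint D) g fun _ => 0 := by
    funext z
    induction z using OnePoint.rec with
    | infty => rw [Function.extend_apply' _ _ _ (by simp)]; rfl
    | coe x => rw [OnePoint.measurableEmbedding_coe.injective.extend_apply]; rfl
  rw [h]
  exact OnePoint.measurableEmbedding_coe.measurable_extend hg measurable_const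

theorem OnePoint.abs_elim_zero_le {D : Type*} {g : D → ℝ} {C : ℝ} (hC0 : 0 ≤ C)
    (hC : ∀ x, |g x| ≤ C) (z : OnePoint D) : |z.elim 0 g| ≤ C := by
  induction z using OnePoint.rec with
  | infty => simpa using hC0
  | coe x => exact hC x

/-! ### Convex sequences in an inner product space -/

section Hankel

variable {E : Type*} [NormedAddCommGroup E] [InnerProductSpace ℝ E]

/-- If `⟪u i, u j⟫` depends only on `i + j`, the square norms of every other increment of step two
sum to at most the total variation of the convex sequence `‖u j‖ ^ 2`. -/
theorem sum_norm_sub_sq_le_of_hankel {u : ℕ → E} {c : ℕ → ℝ}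
    (hu : ∀ i j, inner ℝ (u i) (u j) = c (i + j)) (N : ℕ) :
    ∑ k ∈ Finset.range N, ‖u (2 * k) - u (2 * k + 2)‖ ^ 2 ≤
      (c 0 - c 2) - (c (4 * N) - c (4 * N + 2)) := by
  have hn : ∀ i, ‖u i - u (i + 2)‖ ^ 2 = c (2 * i) - 2 * c (2 * i + 2) + c (2 * i + 4) := by
    intro i
    rw [norm_sub_sq_real, ← real_inner_self_eq_norm_sq, ← real_inner_self_eq_norm_sq, hu, hu, hu]
    ring_nf
  induction N with
  | zero => simp
  | succ N ih =>
    rw [Finset.sum_range_succ]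
    have h1 := hn (2 * N)
    -- The increment at the odd index, absent from the sum, is exactly the slack gained in passing
    -- from `N` to `N + 1`.
    have h2 := hn (2 * N + 1)
    have h3 := sq_nonneg ‖u (2 * N + 1) - u (2 * N + 1 + 2)‖
    rw [h2] at h3
    rw [h1]
    ring_nf at *
    linarith

/-- Each second difference of `c` is the inner product of an increment of `u` with one of `v`.
Cauchy–Schwarz, first in `E` and then over `k`, reduces the sum to the two sums of squared
increments already bounded. -/
theorem abs_sum_second_difference_le_of_hankel {u v : ℕ → E} {a b c : ℕ → ℝ}
    (hu : ∀ i j, inner ℝ (u i) (u j) = a (i + j)) (hv : ∀ i j, inner ℝ (v i) (v j) = b (i + j))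
    (huv : ∀ i j, inner ℝ (u i) (v j) = c (i + j)) (N : ℕ) :
    (∑ k ∈ Finset.range N, (c (4 * k) - 2 * c (4 * k + 2) + c (4 * k + 4))) ^ 2 ≤
      ((a 0 - a 2) - (a (4 * N) - a (4 * N + 2))) *
        ((b 0 - b 2) - (b (4 * N) - b (4 * N + 2))) := by
  have hc : ∀ k, c (4 * k) - 2 * c (4 * k + 2) + c (4 * k + 4) =
      inner ℝ (u (2 * k) - u (2 * k + 2)) (v (2 * k) - v (2 * k + 2)) := by
    intro k
    rw [inner_sub_left, inner_sub_right, inner_sub_right, huv, huv, huv, huv]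
    ring_nf
  have hA := sum_norm_sub_sq_le_of_hankel hu N
  have hB := sum_norm_sub_sq_le_of_hankel hv N
  have h0 : |∑ k ∈ Finset.range N, (c (4 * k) - 2 * c (4 * k + 2) + c (4 * k + 4))| ≤
      ∑ k ∈ Finset.range N, ‖u (2 * k) - u (2 * k + 2)‖ * ‖v (2 * k) - v (2 * k + 2)‖ := by
    refine (Finset.abs_sum_le_sum_abs _ _).trans (Finset.sum_le_sum fun k _ => ?_)
    rw [hc]
    exact abs_real_inner_le_norm _ _
  calc _ = |∑ k ∈ Finset.range N, (c (4 * k) - 2 * c (4 * k + 2) + c (4 * k + 4))| ^ 2 :=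
        (sq_abs _).symm
    _ ≤ _ := pow_le_pow_left₀ (abs_nonneg _) h0 2
    _ ≤ _ := Finset.sum_mul_sq_le_sq_mul_sq _ _ _
    _ ≤ _ := mul_le_mul hA hB (Finset.sum_nonneg fun _ _ => sq_nonneg _)
        ((Finset.sum_nonneg fun _ _ => sq_nonneg _).trans hA)

end Hankel

namespace HuntProcess

variable {D Ω : Type*} [TopologicalSpace D] [T2Space D] [LocallyCompactSpace D]
  [SecondCountableTopology D] [MeasurableSpace Ω] (H : HuntProcess D Ω)

/-! ### Lifetime -/

/-- By right-continuity the infimum defining the lifetime is attained. -/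
theorem X_eq_infty_iff (t : ℝ≥0) (ω : Ω) : H.X t ω = OnePoint.infty ↔ H.lifetime ω ≤ t := by
  refine ⟨fun h => iInf₂_le t h, fun h => ?_⟩
  have hlate : ∀ s, t < s → H.X s ω = OnePoint.infty := by
    intro s hs
    have : H.lifetime ω < s := h.trans_lt (by exact_mod_cast hs)
    simp only [lifetime, iInf_lt_iff] at this
    obtain ⟨r, hr, hrs⟩ := this
    exact H.absorbed ω r s (by exact_mod_cast hrs.le) hr
  have h1 : Tendsto (fun s => H.X s ω) (𝓝[>] t) (𝓝 (H.X t ω)) :=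
    (H.rightCont ω t).mono_left (nhdsWithin_mono _ Ioi_subset_Ici_self)
  have h2 : Tendsto (fun s => H.X s ω) (𝓝[>] t) (𝓝 OnePoint.infty) :=
    tendsto_const_nhds.congr' (by
      filter_upwards [self_mem_nhdsWithin] with s hs using (hlate s hs).symm)
  exact tendsto_nhds_unique h1 h2

theorem X_lifetime_ne_infty_iff (ω ω' : Ω) :
    H.lifetime ω < H.lifetime ω' ↔
      H.lifetime ω < ⊤ ∧ H.X (H.lifetime ω).toNNReal ω' ≠ OnePoint.infty := by
  constructor
  · intro h
    have ht : H.lifetime ω ≠ ⊤ := h.ne_top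
    refine ⟨ht.lt_top, ?_⟩
    rw [Ne, X_eq_infty_iff, ENNReal.coe_toNNReal ht]
    exact not_le.2 h
  · rintro ⟨h, h'⟩
    rwa [Ne, X_eq_infty_iff, ENNReal.coe_toNNReal h.ne, not_le] at h'

theorem ae_X_eq_infty (t : ℝ≥0) : ∀ᵐ ω ∂(H.P OnePoint.infty), H.X t ω = OnePoint.infty := by
  filter_upwards [H.start OnePoint.infty] with ω h
  exact H.absorbed ω 0 t zero_le h

theorem ae_lifetime_pos (x : D) : ∀ᵐ ω ∂(H.P (x : OnePoint D)), 0 < H.lifetime ω := by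
  filter_upwards [H.start x] with ω h
  by_contra h0
  have : H.X 0 ω = OnePoint.infty := by
    rw [X_eq_infty_iff]
    simpa using h0
  exact OnePoint.coe_ne_infty x (h ▸ this)

/-! ### The semigroup -/

/-- Chapman–Kolmogorov is the strong Markov property at a constant time. -/
theorem map_X_add (x : OnePoint D) (s t : ℝ≥0) :
    (H.P x).map (H.X (s + t)) = ((H.P x).map (H.X s)).bind (H.P.map (H.X t)) := by
  ext B hB
  have h := H.strongMarkov (fun _ => (s : WithTop ℝ≥0)) (isStoppingTime_const _ s) x t univ B
    MeasurableSet.univ hB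
  simp only [ne_eq, WithTop.coe_ne_top, not_false_eq_true, ofPred_true, inter_self, univ_inter,
    WithTop.untopD_coe, Measure.restrict_univ] at h
  rw [Measure.map_apply (H.measurable_X _) hB, Measure.bind_apply hB (Kernel.aemeasurable _),
    lintegral_map (Kernel.measurable_coe _ hB) (H.measurable_X s)]
  refine Eq.trans h (lintegral_congr fun ω => ?_)
  rw [Kernel.map_apply' _ (H.measurable_X t) _ hB]
  rfl

theorem integral_elim_X (t : ℝ≥0) (g : D → ℝ) (z : OnePoint D) :
    ∫ ω, (H.X t ω).elim 0 g ∂(H.P z) = z.elim 0 (H.transitionOp t g) := by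
  induction z using OnePoint.rec with
  | infty =>
    refine integral_eq_zero_of_ae ?_
    filter_upwards [H.ae_X_eq_infty t] with ω h
    rw [h]; rfl
  | coe x => rfl

theorem abs_transitionOp_le (t : ℝ≥0) {g : D → ℝ} {C : ℝ} (hC0 : 0 ≤ C) (hC : ∀ x, |g x| ≤ C)
    (x : D) : |H.transitionOp t g x| ≤ C := by
  have := norm_integral_le_of_norm_le_const (μ := H.P (x : OnePoint D))
    (f := fun ω => (H.X t ω).elim 0 g) (C := C)
    (ae_of_all _ fun ω => OnePoint.abs_elim_zero_le hC0 hC _)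
  rw [probReal_univ, mul_one] at this
  exact this

theorem transitionOp_zero {g : D → ℝ} : H.transitionOp 0 g = g := by
  funext x
  have : H.transitionOp 0 g x = ∫ _, g x ∂(H.P (x : OnePoint D)) := by
    refine integral_congr_ae ?_
    filter_upwards [H.start x] with ω h
    rw [h]; rfl
  simpa using this

theorem elim_one_X (s : ℝ≥0) (ω : Ω) :
    (H.X s ω).elim 0 (1 : D → ℝ) = indicator {ω | (s : ℝ≥0∞) < H.lifetime ω} 1 ω := by
  by_cases h : (s : ℝ≥0∞) < H.lifetime ω
  · have h' : H.X s ω ≠ OnePoint.infty := by rwa [Ne, X_eq_infty_iff, not_le]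
    obtain ⟨y, hy⟩ := OnePoint.ne_infty_iff_exists.1 h'
    simp [← hy, h]
  · have h' : H.X s ω = OnePoint.infty := by rwa [X_eq_infty_iff, ← not_lt]
    simp [h', h]

theorem transitionOp_one (t : ℝ≥0) (x : D) :
    H.transitionOp t 1 x = (H.P (x : OnePoint D)).real {ω | (t : ℝ≥0∞) < H.lifetime ω} := by
  rw [← integral_indicator_one (measurableSet_lt measurable_const H.measurable_lifetime)]
  exact integral_congr_ae (ae_of_all _ fun ω => H.elim_one_X t ω)

section

variable [MeasurableSpace D] [BorelSpace D]

theorem measurable_elim_X (t : ℝ≥0) {g : D → ℝ} (hg : Measurable g) :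
    Measurable fun ω => (H.X t ω).elim 0 g :=
  (OnePoint.measurable_elim_zero hg).comp (H.measurable_X t)

theorem measurable_transitionOp (t : ℝ≥0) {g : D → ℝ} (hg : Measurable g) :
    Measurable (H.transitionOp t g) := by
  have h := ((H.measurable_elim_X t hg).stronglyMeasurable.integral_kernel (κ := H.P)).measurable
  exact h.comp OnePoint.measurable_coe_borel

theorem transitionOp_transitionOp (s t : ℝ≥0) {g : D → ℝ} (hg : Measurable g) {C : ℝ}
    (hC0 : 0 ≤ C) (hC : ∀ x, |g x| ≤ C) :
    H.transitionOp s (H.transitionOp t g) = H.transitionOp (s + t) g := by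
  funext x
  have hG := OnePoint.measurable_elim_zero hg
  have : IsMarkovKernel (H.P.map (H.X t)) := Kernel.IsMarkovKernel.map _ (H.measurable_X t)
  have : IsProbabilityMeasure ((H.P (x : OnePoint D)).map (H.X s)) :=
    Measure.isProbabilityMeasure_map (H.measurable_X s).aemeasurable
  have h1 : H.transitionOp (s + t) g x =
      ∫ z, z.elim 0 g ∂((H.P (x : OnePoint D)).map (H.X (s + t))) :=
    (integral_map (H.measurable_X _).aemeasurable hG.aestronglyMeasurable).symm
  rw [h1, map_X_add, Measure.integral_bind_kernel hG (OnePoint.abs_elim_zero_le hC0 hC),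
    integral_map (H.measurable_X s).aemeasurable
      hG.stronglyMeasurable.integral_kernel.aestronglyMeasurable]
  refine integral_congr_ae (ae_of_all _ fun ω => ?_)
  simp only
  rw [Kernel.map_apply _ (H.measurable_X t),
    integral_map (H.measurable_X t).aemeasurable hG.aestronglyMeasurable, integral_elim_X]

-- Self-adjointness moves `P_s` to the other factor, where the semigroup law merges it with `P_t`.
-- For `f = g`, or for `f = 1`, this makes the `L²` inner products depend on the sum of the two
-- times only, as the Hankel lemmas require.
variable {H} in
theorem IsSelfDual.integral_transitionOp_mul {m : Measure D} [IsFiniteMeasure m]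
    (hm : H.IsSelfDual m) (s t : ℝ≥0) {f g : D → ℝ} (hf : Measurable f) (hg : Measurable g)
    {A B : ℝ} (hB0 : 0 ≤ B) (hA : ∀ x, |f x| ≤ A) (hB : ∀ x, |g x| ≤ B) :
    ∫ x, H.transitionOp s f x * H.transitionOp t g x ∂m =
      ∫ x, f x * H.transitionOp (s + t) g x ∂m := by
  have h := hm s f (H.transitionOp t g) hf (H.measurable_transitionOp t hg)
    (MemLp.of_bound hf.aestronglyMeasurable A (ae_of_all _ hA))
    (MemLp.of_bound (H.measurable_transitionOp t hg).aestronglyMeasurable B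
      (ae_of_all _ (H.abs_transitionOp_le t hB0 hB)))
  rw [h, H.transitionOp_transitionOp s t hg hB0 hB]

end

end HuntProcess

/-! ### The process started from `m`, at small and at large times. -/

namespace HuntProcess

variable {D Ω : Type*} [TopologicalSpace D] [T2Space D] [LocallyCompactSpace D]
  [SecondCountableTopology D] [MeasurableSpace Ω] (H : HuntProcess D Ω)
  [MeasurableSpace D]

/-- The law of the process with initial distribution `m`. -/
noncomputable def lawOf (m : Measure D) : Measure Ω :=
  (m.map ((↑) : D → OnePoint D)).bind H.P

/-- The law of a pair of independent copies of the process started from a common point with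
distribution `m`. -/
noncomputable def pairLawOf (m : Measure D) : Measure (Ω × Ω) :=
  (m.map ((↑) : D → OnePoint D)).bind H.pairKernel

instance (m : Measure D) [IsFiniteMeasure m] : IsFiniteMeasure (H.lawOf m) := by
  unfold lawOf; infer_instance

instance (m : Measure D) [IsFiniteMeasure m] : IsFiniteMeasure (H.pairLawOf m) := by
  unfold pairLawOf; infer_instance

variable [BorelSpace D]

theorem integral_lawOf {m : Measure D} [IsFiniteMeasure m] {F : Ω → ℝ} (hF : Measurable F) {C : ℝ}
    (hC : ∀ ω, |F ω| ≤ C) :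
    ∫ ω, F ω ∂(H.lawOf m) = ∫ x : D, ∫ ω, F ω ∂(H.P (x : OnePoint D)) ∂m := by
  rw [lawOf, Measure.integral_bind_kernel hF hC, OnePoint.measurableEmbedding_coe.integral_map]

theorem integral_pairLawOf {m : Measure D} [IsFiniteMeasure m] {F : Ω × Ω → ℝ} (hF : Measurable F)
    {C : ℝ} (hC : ∀ p, |F p| ≤ C) :
    ∫ p, F p ∂(H.pairLawOf m) =
      ∫ x : D, ∫ p, F p ∂((H.P (x : OnePoint D)).prod (H.P (x : OnePoint D))) ∂m := by
  rw [pairLawOf, Measure.integral_bind_kernel hF hC, OnePoint.measurableEmbedding_coe.integral_map]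
  simp [pairKernel, Kernel.parallelComp_apply]

theorem ae_lawOf_iff {m : Measure D} {p : Ω → Prop} (hp : MeasurableSet {ω | p ω}) :
    (∀ᵐ ω ∂(H.lawOf m), p ω) ↔ ∀ᵐ x : D ∂m, ∀ᵐ ω ∂(H.P (x : OnePoint D)), p ω := by
  rw [lawOf, Measure.ae_comp_iff hp, OnePoint.measurableEmbedding_coe.ae_map_iff]

theorem ae_pairLawOf_iff {m : Measure D} {p : Ω × Ω → Prop} (hp : MeasurableSet {ω | p ω}) :
    (∀ᵐ ω ∂(H.pairLawOf m), p ω) ↔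
      ∀ᵐ x : D ∂m, ∀ᵐ ω ∂((H.P (x : OnePoint D)).prod (H.P (x : OnePoint D))), p ω := by
  rw [pairLawOf, Measure.ae_comp_iff hp, OnePoint.measurableEmbedding_coe.ae_map_iff]
  simp [pairKernel, Kernel.parallelComp_apply]

theorem integral_transitionOp_eq_integral_lawOf {m : Measure D} [IsFiniteMeasure m] (t : ℝ≥0)
    {g : D → ℝ} (hg : Measurable g) {C : ℝ} (hC0 : 0 ≤ C) (hC : ∀ x, |g x| ≤ C) :
    ∫ x, H.transitionOp t g x ∂m = ∫ ω, (H.X t ω).elim 0 g ∂(H.lawOf m) := by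
  rw [H.integral_lawOf (H.measurable_elim_X t hg)
    fun ω => OnePoint.abs_elim_zero_le hC0 hC _]
  rfl

theorem ae_lawOf_lifetime_pos (m : Measure D) : ∀ᵐ ω ∂(H.lawOf m), 0 < H.lifetime ω :=
  (H.ae_lawOf_iff (measurableSet_lt measurable_const H.measurable_lifetime)).2
    (ae_of_all _ fun x => H.ae_lifetime_pos x)

/-- A particle started in `D` has positive lifetime, so it is still alive at all sufficiently small
times. -/
theorem tendsto_integral_transitionOp_one_of_tendsto_zero (m : Measure D) [IsFiniteMeasure m]
    {t : ℕ → ℝ≥0} (ht : Tendsto t atTop (𝓝 0)) :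
    Tendsto (fun n => ∫ x, H.transitionOp (t n) 1 x ∂m) atTop
      (𝓝 (∫ x, H.transitionOp 0 1 x ∂m)) := by
  have h1 : ∀ x : D, |(1 : D → ℝ) x| ≤ 1 := by simp
  simp_rw [H.integral_transitionOp_eq_integral_lawOf _ (g := 1) measurable_one zero_le_one h1]
  refine tendsto_integral_of_dominated_convergence (fun _ => 1)
    (fun n => (H.measurable_elim_X _ measurable_one).aestronglyMeasurable) (integrable_const _)
    (fun n => ae_of_all _ fun ω => OnePoint.abs_elim_zero_le zero_le_one h1 _) ?_
  filter_upwards [H.ae_lawOf_lifetime_pos m] with ω hω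
  have hval : ∀ s : ℝ≥0, (s : ℝ≥0∞) < H.lifetime ω → (H.X s ω).elim 0 (1 : D → ℝ) = 1 :=
    fun s hs => by simp [elim_one_X, hs]
  rw [hval 0 (by simpa using hω)]
  have ht' : Tendsto (fun n => (t n : ℝ≥0∞)) atTop (𝓝 0) := by
    rw [← ENNReal.coe_zero]
    exact ENNReal.tendsto_coe.2 ht
  refine tendsto_const_nhds.congr' ?_
  filter_upwards [ht'.eventually_lt_const hω] with n hn using (hval _ hn).symm

/-- A path with finite lifetime is eventually in the cemetery, where `g` is extended by `0`. -/
theorem tendsto_integral_transitionOp_of_tendsto_atTop {m : Measure D} [IsFiniteMeasure m]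
    (hfin : ∀ᵐ ω ∂(H.lawOf m), H.lifetime ω < ⊤) {t : ℕ → ℝ≥0} (ht : Tendsto t atTop atTop)
    {g : D → ℝ} (hg : Measurable g) {C : ℝ} (hC0 : 0 ≤ C) (hC : ∀ x, |g x| ≤ C) :
    Tendsto (fun n => ∫ x, H.transitionOp (t n) g x ∂m) atTop (𝓝 0) := by
  simp_rw [H.integral_transitionOp_eq_integral_lawOf _ hg hC0 hC]
  suffices h : Tendsto (fun n => ∫ ω, (H.X (t n) ω).elim 0 g ∂(H.lawOf m)) atTop
      (𝓝 (∫ _, (0 : ℝ) ∂(H.lawOf m))) by simpa using h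
  refine tendsto_integral_of_dominated_convergence (fun _ => C)
    (fun n => (H.measurable_elim_X _ hg).aestronglyMeasurable) (integrable_const _)
    (fun n => ae_of_all _ fun ω => OnePoint.abs_elim_zero_le hC0 hC _) ?_
  filter_upwards [hfin] with ω hω
  refine tendsto_const_nhds.congr' ?_
  filter_upwards [ht.eventually_ge_atTop (H.lifetime ω).toNNReal] with n hn
  have : H.X (t n) ω = OnePoint.infty := by
    rw [X_eq_infty_iff, ← ENNReal.coe_toNNReal hω.ne]
    exact_mod_cast hn
  simp [this]

/-! ### Riemann sums along the diagonal, by self-duality. -/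

section SelfDual

variable {H}
variable {m : Measure D} [IsFiniteMeasure m] (hm : H.IsSelfDual m)

include hm

/-- The Hankel estimate for `u i = P_{iε} 1` and `v j = P_{jε} g` in `L²(m)`. The point of the bound
is that its first factor, the mass lost up to time `2ε`, is small while the second is bounded
uniformly in `N` and `ε`. -/
theorem IsSelfDual.sq_sum_second_difference_le (ε : ℝ≥0) (N : ℕ) {g : D → ℝ} (hg : Measurable g)
    {C : ℝ} (hC0 : 0 ≤ C) (hC : ∀ x, |g x| ≤ C) {a c : ℕ → ℝ}
    (ha : ∀ j, a j = ∫ x, H.transitionOp (j * ε) 1 x ∂m)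
    (hc : ∀ j, c j = ∫ x, H.transitionOp (j * ε) g x ∂m) :
    (∑ k ∈ Finset.range N, (c (4 * k) - 2 * c (4 * k + 2) + c (4 * k + 4))) ^ 2 ≤
      (a 0 - a 2) * (4 * (C * C * m.real univ)) := by
  have h1 : ∀ x : D, |(1 : D → ℝ) x| ≤ 1 := by simp
  have hmem : ∀ (j : ℕ) {f : D → ℝ} {B : ℝ}, Measurable f → 0 ≤ B → (∀ x, |f x| ≤ B) →
      MemLp (H.transitionOp (j * ε) f) 2 m := fun j f B hf hB0 hB =>
    MemLp.of_bound (H.measurable_transitionOp _ hf).aestronglyMeasurable B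
      (ae_of_all _ (H.abs_transitionOp_le _ hB0 hB))
  have hinner : ∀ {f f' : D → ℝ} {B B' : ℝ} (hf : Measurable f) (hB0 : 0 ≤ B)
      (hB : ∀ x, |f x| ≤ B) (hf' : Measurable f') (hB0' : 0 ≤ B') (hB' : ∀ x, |f' x| ≤ B')
      (i j : ℕ), inner ℝ ((hmem i hf hB0 hB).toLp _) ((hmem j hf' hB0' hB').toLp _) =
        ∫ x, f x * H.transitionOp ((i + j : ℕ) * ε) f' x ∂m := by
    intro f f' B B' hf hB0 hB hf' hB0' hB' i j
    have h := hm.integral_transitionOp_mul (i * ε) (j * ε) hf hf' hB0' hB hB'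
    rw [L2.inner_def]
    push_cast
    rw [add_mul, ← h]
    refine integral_congr_ae ?_
    filter_upwards [(hmem i hf hB0 hB).coeFn_toLp, (hmem j hf' hB0' hB').coeFn_toLp] with x hx hx'
    rw [hx, hx']
    simp [mul_comm]
  have hu := hinner measurable_one zero_le_one h1 measurable_one zero_le_one h1
  have huv := hinner measurable_one zero_le_one h1 hg hC0 hC
  have hv := hinner hg hC0 hC hg hC0 hC
  have key := abs_sum_second_difference_le_of_hankel (a := a) (c := c)
    (b := fun j => ∫ x, g x * H.transitionOp (j * ε) g x ∂m)
    (u := fun i => (hmem i measurable_one zero_le_one h1).toLp _)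
    (v := fun j => (hmem j hg hC0 hC).toLp _)
    (fun i j => by rw [hu, ha]; simp) hv (fun i j => by rw [huv, hc]; simp) N
  have hanti : ∀ i j, i ≤ j → a j ≤ a i := by
    intro i j hij
    rw [ha, ha]
    refine integral_mono
      ((hmem j measurable_one zero_le_one h1).integrable one_le_two)
      ((hmem i measurable_one zero_le_one h1).integrable one_le_two) fun x => ?_
    simp only [transitionOp_one]
    refine measureReal_mono fun ω (hω : _ < _) => mem_ofPred.2 (lt_of_le_of_lt ?_ hω)
    gcongr
  have hb : ∀ j : ℕ, |∫ x, g x * H.transitionOp (j * ε) g x ∂m| ≤ C * C * m.real univ := by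
    intro j
    refine (Real.norm_eq_abs _).symm.trans_le
      (norm_integral_le_of_norm_le_const (ae_of_all _ fun x => ?_))
    rw [norm_mul]
    exact mul_le_mul (hC x) (H.abs_transitionOp_le _ hC0 hC x) (norm_nonneg _) hC0
  refine key.trans ?_
  -- `P_t 1` decreases in `t`: `e2` allows the last increment of `a` to be dropped, and `e1` makes
  -- the remaining factor nonnegative. The factor `4` counts the four values of the second sequence,
  -- each at most `C * C * m.real univ` in absolute value.
  have e1 := hanti 0 2 (by norm_num)
  have e2 := hanti (4 * N) (4 * N + 2) (by omega)
  have b1 := abs_le.1 (hb 0)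
  have b2 := abs_le.1 (hb 2)
  have b3 := abs_le.1 (hb (4 * N))
  have b4 := abs_le.1 (hb (4 * N + 2))
  have hY := (Finset.sum_nonneg fun _ _ => sq_nonneg _).trans
    (sum_norm_sub_sq_le_of_hankel (c := fun j => ∫ x, g x * H.transitionOp (j * ε) g x ∂m)
      (u := fun j => (hmem j hg hC0 hC).toLp _) hv N)
  exact mul_le_mul (by linarith) (by linarith) hY (by linarith)

theorem IsSelfDual.tendsto_riemann_sum (hfin : ∀ᵐ ω ∂(H.lawOf m), H.lifetime ω < ⊤)
    {g : D → ℝ} (hg : Measurable g) {C : ℝ} (hC0 : 0 ≤ C) (hC : ∀ x, |g x| ≤ C) :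
    Tendsto (fun n : ℕ => ∑ k ∈ Finset.range ((n + 1) ^ 2),
        ∫ x, (H.transitionOp (k / (n + 1)) 1 x - H.transitionOp ((k + 1) / (n + 1)) 1 x) *
          H.transitionOp ((k + 1) / (n + 1)) g x ∂m)
      atTop (𝓝 ((∫ x, g x ∂m) / 2)) := by
  have h1 : ∀ x : D, |(1 : D → ℝ) x| ≤ 1 := by simp
  -- Half the mesh: the grid point `k / (n + 1)` is `2 * k * ε n`, and the Hankel estimate also uses
  -- the odd multiples of `ε n`.
  let ε : ℕ → ℝ≥0 := fun n => 1 / (2 * (n + 1))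
  let c : ℕ → ℕ → ℝ := fun n j => ∫ x, H.transitionOp (j * ε n) g x ∂m
  let a : ℕ → ℕ → ℝ := fun n j => ∫ x, H.transitionOp (j * ε n) 1 x ∂m
  let R : ℕ → ℝ := fun n =>
    ∑ k ∈ Finset.range ((n + 1) ^ 2), (c n (4 * k) - 2 * c n (4 * k + 2) + c n (4 * k + 4))
  have hint : ∀ s t : ℝ≥0, Integrable (fun x => H.transitionOp s 1 x * H.transitionOp t g x) m :=
    fun s t => Integrable.of_bound ((H.measurable_transitionOp s measurable_one).mul
      (H.measurable_transitionOp t hg)).aestronglyMeasurable (1 * C) (ae_of_all _ fun x => by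
        rw [norm_mul]
        exact mul_le_mul (H.abs_transitionOp_le _ zero_le_one h1 x)
          (H.abs_transitionOp_le _ hC0 hC x) (norm_nonneg _) zero_le_one)
  have hterm : ∀ n k : ℕ,
      ∫ x, (H.transitionOp (k / (n + 1)) 1 x - H.transitionOp ((k + 1) / (n + 1)) 1 x) *
          H.transitionOp ((k + 1) / (n + 1)) g x ∂m = c n (4 * k + 2) - c n (4 * k + 4) := by
    intro n k
    simp_rw [sub_mul]
    rw [integral_sub (hint _ _) (hint _ _),
      hm.integral_transitionOp_mul _ _ measurable_one hg hC0 h1 hC,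
      hm.integral_transitionOp_mul _ _ measurable_one hg hC0 h1 hC]
    simp only [Pi.one_apply, one_mul, c, ε]
    congr! 4
    · push_cast; field_simp; ring
    · push_cast; field_simp; ring
  -- The sum collects the increments over `[4k + 2, 4k + 4]`. It is half the full telescoping sum,
  -- up to half of `R n`, the total excess of the increments over `[4k, 4k + 2]`.
  have hS : ∀ n : ℕ, ∑ k ∈ Finset.range ((n + 1) ^ 2),
        ∫ x, (H.transitionOp (k / (n + 1)) 1 x - H.transitionOp ((k + 1) / (n + 1)) 1 x) *
          H.transitionOp ((k + 1) / (n + 1)) g x ∂m =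
      (c n 0 - c n (4 * (n + 1) ^ 2) - R n) / 2 := by
    intro n
    have htel : c n 0 - c n (4 * (n + 1) ^ 2) =
        ∑ k ∈ Finset.range ((n + 1) ^ 2), (c n (4 * k) - c n (4 * (k + 1))) :=
      (Finset.sum_range_sub' (fun k => c n (4 * k)) _).symm
    rw [htel, ← Finset.sum_sub_distrib, Finset.sum_div]
    refine Finset.sum_congr rfl fun k _ => ?_
    rw [hterm]
    ring_nf
  have hR2 : Tendsto (fun n => R n ^ 2) atTop (𝓝 0) := by
    have ha : Tendsto (fun n => (a n 0 - a n 2) * (4 * (C * C * m.real univ))) atTop (𝓝 0) := by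
      have h2 := H.tendsto_integral_transitionOp_one_of_tendsto_zero m
        (t := fun n => (2 : ℕ) * ε n) (by
          have h3 := tendsto_one_div_add_atTop_nhds_zero_nat (𝕜 := ℝ≥0)
          refine h3.congr fun n => ?_
          simp only [ε]; push_cast; field_simp)
      have h4 : Tendsto (fun n => a n 0 - a n 2) atTop (𝓝 0) := by
        have := (tendsto_const_nhds (x := ∫ x, H.transitionOp 0 1 x ∂m)).sub h2
        rw [sub_self] at this
        refine this.congr fun n => ?_
        simp [a]
      simpa using h4.mul_const (4 * (C * C * m.real univ))
    exact squeeze_zero (fun n => sq_nonneg _) (fun n =>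
      hm.sq_sum_second_difference_le (ε n) _ hg hC0 hC (fun _ => rfl) fun _ => rfl) ha
  have hR : Tendsto R atTop (𝓝 0) := by
    have := hR2.sqrt
    simp_rw [Real.sqrt_sq_eq_abs, Real.sqrt_zero] at this
    exact (tendsto_zero_iff_abs_tendsto_zero _).2 this
  -- The index `4 * (n + 1) ^ 2` stands for the time `2 * (n + 1)`, which tends to infinity.
  have hcN : Tendsto (fun n => c n (4 * (n + 1) ^ 2)) atTop (𝓝 0) := by
    have ht : Tendsto (fun n : ℕ => (2 * (n + 1) : ℝ≥0)) atTop atTop := by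
      have := (tendsto_natCast_atTop_atTop (R := ℝ≥0)).comp
        ((tendsto_add_atTop_nat 1).const_mul_atTop' (r := 2) (by norm_num))
      refine this.congr fun n => ?_
      simp
    refine (H.tendsto_integral_transitionOp_of_tendsto_atTop hfin ht hg hC0 hC).congr fun n => ?_
    simp only [c, ε]
    congr! 3
    push_cast; field_simp; ring
  have hc0 : ∀ n, c n 0 = ∫ x, g x ∂m := by
    intro n
    simp [c, transitionOp_zero]
  simp_rw [hS, hc0]
  have := (((tendsto_const_nhds (x := ∫ x, g x ∂m)).sub hcN).sub hR).div_const 2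
  simpa using this

end SelfDual

end HuntProcess

namespace HuntProcess

variable {D Ω : Type*} [TopologicalSpace D] [T2Space D] [LocallyCompactSpace D]
  [SecondCountableTopology D] [MeasurableSpace Ω] (H : HuntProcess D Ω)

/-! ### The first branching position, started from the diagonal -/

/-- For a pair of paths, the value of `g` at the position of the first particle at the death of the
second one; zero if the second particle does not die strictly before the first one. -/
noncomputable def valueAtDeath (g : D → ℝ) (p : Ω × Ω) : ℝ :=
  open Classical in
  if H.lifetime p.2 < ⊤ then (H.X (H.lifetime p.2).toNNReal p.1).elim 0 g else 0

theorem antitone_elim_one_X (ω : Ω) : Antitone fun s => (H.X s ω).elim 0 (1 : D → ℝ) := by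
  intro s t hst
  simp only [elim_one_X]
  refine indicator_le_indicator_of_subset ?_ (fun _ => zero_le_one) ω
  intro ω' (hω' : (t : ℝ≥0∞) < _)
  exact lt_of_le_of_lt (by exact_mod_cast hst) hω'

/-- Replacing `f` by `0` at the cemetery may destroy its continuity, but not right-continuity along
a path: a dead path stays dead, and a living one stays off the cemetery for a short while. -/
theorem tendsto_elim_X (f : OnePoint D → ℝ) (hf : Continuous f) (ω : Ω) (t : ℝ≥0) :
    Tendsto (fun s => (H.X s ω).elim 0 fun x => f x) (𝓝[≥] t)
      (𝓝 ((H.X t ω).elim 0 fun x => f x)) := by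
  by_cases h : H.X t ω = OnePoint.infty
  · refine tendsto_const_nhds.congr' ?_
    filter_upwards [self_mem_nhdsWithin] with s hs
    rw [h, H.absorbed ω t s hs h]
  · have helim : ∀ z : OnePoint D, z ≠ OnePoint.infty → (z.elim 0 fun x => f x) = f z := by
      intro z hz
      obtain ⟨y, rfl⟩ := OnePoint.ne_infty_iff_exists.1 hz
      rfl
    rw [helim _ h]
    refine ((hf.tendsto _).comp (H.rightCont ω t)).congr' ?_
    filter_upwards [(H.rightCont ω t).eventually (isOpen_compl_singleton.mem_nhds h)] with s hs
    exact (helim _ hs).symm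

/-- Approximation of `valueAtDeath` with the death time rounded up to the grid of mesh
`1 / (n + 1)`. -/
noncomputable def gridValueAtDeath (n : ℕ) (g : D → ℝ) (p : Ω × Ω) : ℝ :=
  ∑ k ∈ Finset.range ((n + 1) ^ 2),
    (H.X ((k + 1) / (n + 1)) p.1).elim 0 g *
      ((H.X (k / (n + 1)) p.2).elim 0 (1 : D → ℝ) -
        (H.X ((k + 1) / (n + 1)) p.2).elim 0 (1 : D → ℝ))

/-- The differences of survival indicators are nonnegative weights telescoping to at most `1`. The
bound is uniform in `n` and serves for dominated convergence. -/
theorem abs_gridValueAtDeath_le (n : ℕ) {g : D → ℝ} {C : ℝ} (hC0 : 0 ≤ C) (hC : ∀ x, |g x| ≤ C)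
    (p : Ω × Ω) : |H.gridValueAtDeath n g p| ≤ C := by
  have h1 : ∀ x : D, |(1 : D → ℝ) x| ≤ 1 := by simp
  set u : ℕ → ℝ := fun k => (H.X (k / (n + 1)) p.2).elim 0 (1 : D → ℝ) with hu
  have hu1 : ∀ k : ℕ, (H.X ((k + 1) / (n + 1)) p.2).elim 0 (1 : D → ℝ) = u (k + 1) := by
    intro k; simp [hu]
  have hu0 : ∀ k, 0 ≤ u k := fun k => by
    simp only [hu, elim_one_X]
    exact indicator_nonneg (fun _ _ => zero_le_one) _
  have hstep : ∀ k, 0 ≤ u k - u (k + 1) := fun k => by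
    refine sub_nonneg.2 (H.antitone_elim_one_X p.2 ?_)
    gcongr
    simp
  calc |H.gridValueAtDeath n g p|
      ≤ ∑ k ∈ Finset.range ((n + 1) ^ 2), C * (u k - u (k + 1)) := by
        refine (Finset.abs_sum_le_sum_abs _ _).trans (Finset.sum_le_sum fun k _ => ?_)
        rw [hu1, abs_mul, abs_of_nonneg (hstep k)]
        exact mul_le_mul_of_nonneg_right (OnePoint.abs_elim_zero_le hC0 hC _) (hstep k)
    _ = C * (u 0 - u ((n + 1) ^ 2)) := by
        rw [← Finset.mul_sum, Finset.sum_range_sub']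
    _ ≤ C * 1 := by
        refine mul_le_mul_of_nonneg_left ?_ hC0
        have := (abs_le.1 (OnePoint.abs_elim_zero_le zero_le_one h1
          (H.X ((0 : ℕ) / (n + 1)) p.2))).2
        exact (sub_le_self _ (hu0 _)).trans this
    _ = C := mul_one C

theorem gridValueAtDeath_eq (n : ℕ) (g : D → ℝ) {p : Ω × Ω} (h0 : 0 < H.lifetime p.2)
    (hn : H.lifetime p.2 ≤ n + 1) :
    H.gridValueAtDeath n g p =
      (H.X (⌈((n : ℝ≥0) + 1) * (H.lifetime p.2).toNNReal⌉₊ / (n + 1)) p.1).elim 0 g := by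
  set T := (H.lifetime p.2).toNNReal with hT
  have htop : H.lifetime p.2 ≠ ⊤ := (hn.trans_lt (by finiteness)).ne
  have hTe : H.lifetime p.2 = T := (ENNReal.coe_toNNReal htop).symm
  have hT0 : 0 < T := by rw [hTe] at h0; exact_mod_cast h0
  have hTn : T ≤ n + 1 := by rw [hTe] at hn; exact_mod_cast hn
  -- The cells are open on the left, so a death at time `0` would lie in none of them. The `(n + 1)
  -- ^ 2` cells of mesh `1 / (n + 1)` cover the times up to `n + 1`.
  have hpos : 0 < ⌈((n : ℝ≥0) + 1) * T⌉₊ := Nat.ceil_pos.2 (by positivity)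
  obtain ⟨K, hK⟩ : ∃ K, ⌈((n : ℝ≥0) + 1) * T⌉₊ = K + 1 := ⟨_, (Nat.succ_pred_eq_of_pos hpos).symm⟩
  have hval : ∀ k : ℕ, (H.X (k / (n + 1)) p.2).elim 0 (1 : D → ℝ) = if k < K + 1 then 1 else 0 := by
    intro k
    have : ((k / (n + 1) : ℝ≥0) : ℝ≥0∞) < H.lifetime p.2 ↔ k < K + 1 := by
      rw [hTe, ENNReal.coe_lt_coe, ← hK, Nat.lt_ceil, div_lt_iff₀ (by positivity), mul_comm]
    rw [elim_one_X, indicator_apply]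
    exact if_congr this rfl rfl
  have hKn : K ∈ Finset.range ((n + 1) ^ 2) := by
    rw [Finset.mem_range, ← Nat.succ_le_iff, Nat.succ_eq_add_one, ← hK, Nat.ceil_le]
    push_cast
    rw [sq]
    gcongr
  rw [gridValueAtDeath, Finset.sum_eq_single_of_mem K hKn, hK]
  · have h2 := hval (K + 1)
    push_cast at h2 ⊢
    rw [h2, hval K]
    simp
  · intro k _ hk
    have h2 := hval (k + 1)
    push_cast at h2
    rw [h2, hval k]
    rcases lt_or_gt_of_ne hk with h | h
    · rw [if_pos (by omega), if_pos (by omega)]; simp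
    · rw [if_neg (by omega), if_neg (by omega)]; simp

theorem tendsto_gridValueAtDeath (f : OnePoint D → ℝ) (hf : Continuous f) {p : Ω × Ω}
    (h0 : 0 < H.lifetime p.2) :
    Tendsto (fun n => H.gridValueAtDeath n (fun x => f x) p) atTop
      (𝓝 (H.valueAtDeath (fun x => f x) p)) := by
  by_cases htop : H.lifetime p.2 < ⊤
  · rw [valueAtDeath, if_pos htop]
    set T := (H.lifetime p.2).toNNReal with hT
    have hTe : H.lifetime p.2 = T := (ENNReal.coe_toNNReal htop.ne).symm
    have hlow : ∀ n : ℕ, T ≤ (⌈((n : ℝ≥0) + 1) * T⌉₊ : ℝ≥0) / (n + 1) := fun n => by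
      rw [le_div_iff₀ (by positivity), mul_comm]
      exact Nat.le_ceil _
    have hup : ∀ n : ℕ, (⌈((n : ℝ≥0) + 1) * T⌉₊ : ℝ≥0) / (n + 1) ≤ T + 1 / ((n : ℝ≥0) + 1) := by
      intro n
      rw [div_le_iff₀ (by positivity), add_mul T, one_div, inv_mul_cancel₀ (by positivity), mul_comm T]
      exact (Nat.ceil_lt_add_one zero_le).le
    have hlim : Tendsto (fun n : ℕ => (⌈((n : ℝ≥0) + 1) * T⌉₊ : ℝ≥0) / (n + 1)) atTop
        (𝓝[≥] T) := by
      refine tendsto_nhdsWithin_iff.2 ⟨?_, Eventually.of_forall hlow⟩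
      refine tendsto_of_tendsto_of_tendsto_of_le_of_le tendsto_const_nhds ?_ hlow hup
      simpa using tendsto_const_nhds.add (tendsto_one_div_add_atTop_nhds_zero_nat (𝕜 := ℝ≥0))
    refine ((H.tendsto_elim_X f hf p.1 T).comp hlim).congr' ?_
    obtain ⟨N, hN⟩ := exists_nat_ge T
    filter_upwards [eventually_ge_atTop N] with n hn
    rw [H.gridValueAtDeath_eq n _ h0]
    · rfl
    · rw [hTe]
      have : T ≤ n + 1 := hN.trans ((Nat.cast_le.2 hn).trans (by simp))
      exact_mod_cast this
  · rw [valueAtDeath, if_neg htop]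
    refine tendsto_const_nhds.congr fun n => ?_
    have hlt : H.lifetime p.2 = ⊤ := by simpa using htop
    refine (Finset.sum_eq_zero fun k _ => ?_).symm
    rw [elim_one_X, elim_one_X]
    simp [hlt, -ENNReal.coe_div]

-- `valueAtDeath` vanishes on a pair unless its first particle strictly outlives the second, so
-- exactly one of the three terms is active in each case.
open Classical in
theorem apply_survivor_eq (f : OnePoint D → ℝ) (p : Ω × Ω) :
    f (H.survivor p) = H.valueAtDeath (fun x => f x) p + H.valueAtDeath (fun x => f x) p.swap +
      {p : Ω × Ω | H.lifetime p.1 = H.lifetime p.2}.indicator (fun _ => f OnePoint.infty) p := by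
  have hval : ∀ q : Ω × Ω, H.lifetime q.2 < H.lifetime q.1 →
      H.valueAtDeath (fun x => f x) q = f (H.X (H.lifetime q.2).toNNReal q.1) := by
    intro q hq
    obtain ⟨h1, h2⟩ := (H.X_lifetime_ne_infty_iff _ _).1 hq
    obtain ⟨y, hy⟩ := OnePoint.ne_infty_iff_exists.1 h2
    rw [valueAtDeath, if_pos h1, ← hy]
    rfl
  have hzero : ∀ q : Ω × Ω, ¬ H.lifetime q.2 < H.lifetime q.1 →
      H.valueAtDeath (fun x => f x) q = 0 := by
    intro q hq
    rw [X_lifetime_ne_infty_iff] at hq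
    rw [valueAtDeath]
    split_ifs with h1
    · rw [not_not.1 fun h => hq ⟨h1, h⟩]
      rfl
    · rfl
  rw [survivor]
  rcases lt_trichotomy (H.lifetime p.1) (H.lifetime p.2) with h | h | h
  · rw [if_neg h.not_gt, if_pos h, hzero p h.not_gt, hval p.swap h,
      indicator_of_notMem (by simpa using h.ne)]
    simp
  · rw [if_neg h.not_gt, if_neg h.not_lt, hzero p h.not_gt, hzero p.swap h.not_lt,
      indicator_of_mem (by exact h)]
    simp
  · rw [if_pos h, hzero p.swap h.not_gt, hval p h, indicator_of_notMem (by simpa using h.ne')]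
    simp

theorem measurableSet_lifetime_eq : MeasurableSet {p : Ω × Ω | H.lifetime p.1 = H.lifetime p.2} :=
  measurableSet_eq_fun (H.measurable_lifetime.comp measurable_fst)
    (H.measurable_lifetime.comp measurable_snd)

theorem abs_valueAtDeath_le {g : D → ℝ} {C : ℝ} (hC0 : 0 ≤ C) (hC : ∀ x, |g x| ≤ C) (p : Ω × Ω) :
    |H.valueAtDeath g p| ≤ C := by
  rw [valueAtDeath]
  split_ifs
  · exact OnePoint.abs_elim_zero_le hC0 hC _
  · simpa using hC0

variable [MeasurableSpace D] [BorelSpace D]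

theorem measurable_valueAtDeath {g : D → ℝ} (hg : Measurable g) :
    Measurable (H.valueAtDeath g) := by
  have h2 : Measurable fun p : Ω × Ω => H.lifetime p.2 := H.measurable_lifetime.comp measurable_snd
  exact Measurable.ite (measurableSet_lt h2 measurable_const)
    ((OnePoint.measurable_elim_zero hg).comp
      (H.measurable_X_comp h2.ennreal_toNNReal measurable_fst)) measurable_const

theorem measurable_gridValueAtDeath (n : ℕ) {g : D → ℝ} (hg : Measurable g) :
    Measurable (H.gridValueAtDeath n g) :=
  Finset.measurable_sum _ fun _ _ => ((H.measurable_elim_X _ hg).comp measurable_fst).mul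
    (((H.measurable_elim_X _ measurable_one).comp measurable_snd).sub
      ((H.measurable_elim_X _ measurable_one).comp measurable_snd))

/-- Given the starting point, the two copies are independent, so each expectation factors into
transition operators. -/
theorem integral_gridValueAtDeath {m : Measure D} [IsFiniteMeasure m] (n : ℕ) {g : D → ℝ}
    (hg : Measurable g) {C : ℝ} (hC0 : 0 ≤ C) (hC : ∀ x, |g x| ≤ C) :
    ∫ p, H.gridValueAtDeath n g p ∂(H.pairLawOf m) =
      ∑ k ∈ Finset.range ((n + 1) ^ 2),
        ∫ x, (H.transitionOp (k / (n + 1)) 1 x - H.transitionOp ((k + 1) / (n + 1)) 1 x) *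
          H.transitionOp ((k + 1) / (n + 1)) g x ∂m := by
  have h1 : ∀ x : D, |(1 : D → ℝ) x| ≤ 1 := by simp
  have hmeas : ∀ s t r : ℝ≥0, Measurable fun p : Ω × Ω => (H.X s p.1).elim 0 g *
      ((H.X t p.2).elim 0 (1 : D → ℝ) - (H.X r p.2).elim 0 (1 : D → ℝ)) := fun s t r =>
    ((H.measurable_elim_X _ hg).comp measurable_fst).mul
      (((H.measurable_elim_X _ measurable_one).comp measurable_snd).sub
        ((H.measurable_elim_X _ measurable_one).comp measurable_snd))
  have hbd : ∀ (s t r : ℝ≥0) (p : Ω × Ω), |(H.X s p.1).elim 0 g *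
      ((H.X t p.2).elim 0 (1 : D → ℝ) - (H.X r p.2).elim 0 (1 : D → ℝ))| ≤ C * (1 + 1) := by
    intro s t r p
    rw [abs_mul]
    refine mul_le_mul (OnePoint.abs_elim_zero_le hC0 hC _) ((abs_sub _ _).trans ?_)
      (abs_nonneg _) hC0
    exact add_le_add (OnePoint.abs_elim_zero_le zero_le_one h1 _)
      (OnePoint.abs_elim_zero_le zero_le_one h1 _)
  simp only [gridValueAtDeath]
  rw [integral_finsetSum _ fun k _ => Integrable.of_bound (hmeas _ _ _).aestronglyMeasurable _
    (ae_of_all _ (hbd _ _ _))]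
  refine Finset.sum_congr rfl fun k _ => ?_
  rw [H.integral_pairLawOf (hmeas _ _ _) (hbd _ _ _)]
  refine integral_congr_ae (ae_of_all _ fun x => ?_)
  have hi : ∀ t : ℝ≥0, Integrable (fun ω => (H.X t ω).elim 0 (1 : D → ℝ))
      (H.P (x : OnePoint D)) := fun t =>
    Integrable.of_bound (H.measurable_elim_X _ measurable_one).aestronglyMeasurable 1
      (ae_of_all _ fun ω => OnePoint.abs_elim_zero_le zero_le_one h1 _)
  simp only
  rw [integral_prod_mul (fun ω => (H.X ((k + 1) / (n + 1)) ω).elim 0 g)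
    (fun ω => (H.X (k / (n + 1)) ω).elim 0 (1 : D → ℝ) -
      (H.X ((k + 1) / (n + 1)) ω).elim 0 (1 : D → ℝ)), integral_sub (hi _) (hi _), mul_comm]
  rfl

/-! ### The survivor's law from the diagonal is `m`. -/

section SelfDual

variable {H}
variable {m : Measure D} [IsFiniteMeasure m] (hm : H.IsSelfDual m)
  (hfin : ∀ᵐ ω ∂(H.lawOf m), H.lifetime ω < ⊤)

include hm hfin

theorem IsSelfDual.integral_valueAtDeath {f : OnePoint D → ℝ} (hf : Continuous f) {C : ℝ}
    (hC0 : 0 ≤ C) (hC : ∀ z, |f z| ≤ C) :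
    ∫ p, H.valueAtDeath (fun x => f x) p ∂(H.pairLawOf m) = (∫ x : D, f x ∂m) / 2 := by
  have hg : Measurable fun x : D => f x := hf.measurable.comp OnePoint.measurable_coe_borel
  have hr := hm.tendsto_riemann_sum hfin hg hC0 fun x => hC x
  simp_rw [← H.integral_gridValueAtDeath _ hg hC0 fun x => hC x] at hr
  refine tendsto_nhds_unique (tendsto_integral_of_dominated_convergence (fun _ => C)
    (fun n => (H.measurable_gridValueAtDeath n hg).aestronglyMeasurable) (integrable_const _)
    (fun n => ae_of_all _ fun p => H.abs_gridValueAtDeath_le n hC0 (fun x => hC x) p) ?_) hr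
  have hpos : ∀ᵐ p ∂(H.pairLawOf m), 0 < H.lifetime p.2 := by
    refine (H.ae_pairLawOf_iff (measurableSet_lt measurable_const
      (H.measurable_lifetime.comp measurable_snd))).2 (ae_of_all _ fun x => ?_)
    exact Measure.quasiMeasurePreserving_snd.ae (H.ae_lifetime_pos x)
  filter_upwards [hpos] with p hp using H.tendsto_gridValueAtDeath f hf hp

/-- Exchanging the particles preserves `pairLawOf`, so each of the two orders of death contributes
half of `∫ f dm`; simultaneous deaths put their mass at the cemetery. -/
theorem IsSelfDual.integral_survivor {f : OnePoint D → ℝ} (hf : Continuous f) {C : ℝ}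
    (hC0 : 0 ≤ C) (hC : ∀ z, |f z| ≤ C) :
    ∫ p, f (H.survivor p) ∂(H.pairLawOf m) = ∫ x : D, f x ∂m +
      (H.pairLawOf m).real {p | H.lifetime p.1 = H.lifetime p.2} * f OnePoint.infty := by
  have hg : Measurable fun x : D => f x := hf.measurable.comp OnePoint.measurable_coe_borel
  have hV := H.measurable_valueAtDeath hg
  have hVC := H.abs_valueAtDeath_le hC0 fun x => hC x
  have hi1 : Integrable (H.valueAtDeath fun x => f x) (H.pairLawOf m) :=
    Integrable.of_bound hV.aestronglyMeasurable C (ae_of_all _ hVC)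
  have hi2 : Integrable (fun p => H.valueAtDeath (fun x => f x) p.swap) (H.pairLawOf m) :=
    Integrable.of_bound (hV.comp measurable_swap).aestronglyMeasurable C
      (ae_of_all _ fun p => hVC _)
  have hswap : ∫ p, H.valueAtDeath (fun x => f x) p.swap ∂(H.pairLawOf m) =
      ∫ p, H.valueAtDeath (fun x => f x) p ∂(H.pairLawOf m) := by
    rw [H.integral_pairLawOf (F := fun p => H.valueAtDeath (fun x => f x) p.swap)
      (hV.comp measurable_swap) fun p => hVC _, H.integral_pairLawOf hV hVC]
    exact integral_congr_ae (ae_of_all _ fun x => integral_prod_swap _)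
  simp_rw [H.apply_survivor_eq f]
  rw [integral_add (f := fun p => _ + _) (hi1.add hi2) ((integrable_const _).indicator H.measurableSet_lifetime_eq),
    integral_add hi1 hi2, hswap, hm.integral_valueAtDeath hfin hf hC0 hC,
    integral_indicator_const _ H.measurableSet_lifetime_eq, add_halves, smul_eq_mul]

/-- Conservation of mass: for `f = 1` the two strict orders of death already account for all of `m`.
-/
theorem IsSelfDual.pairLawOf_lifetime_eq :
    H.pairLawOf m {p | H.lifetime p.1 = H.lifetime p.2} = 0 := by
  have h1 := hm.integral_survivor hfin (f := fun _ => 1) continuous_const zero_le_one (by simp)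
  have h2 := H.integral_pairLawOf (m := m) (F := fun _ => 1) measurable_const (C := 1) (by simp)
  rw [h2] at h1
  have h3 : (H.pairLawOf m).real {p | H.lifetime p.1 = H.lifetime p.2} = 0 := by
    simpa using h1
  exact (measureReal_eq_zero_iff).1 h3

theorem IsSelfDual.map_survivor_pairLawOf :
    (H.pairLawOf m).map H.survivor = m.map ((↑) : D → OnePoint D) := by
  have h0 : (H.pairLawOf m).real {p | H.lifetime p.1 = H.lifetime p.2} = 0 := by
    simp [measureReal_def, hm.pairLawOf_lifetime_eq hfin]
  refine ext_of_forall_integral_eq_of_IsFiniteMeasure fun f => ?_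
  have h := hm.integral_survivor hfin f.continuous (norm_nonneg f) f.norm_coe_le_norm
  rw [integral_map H.measurable_survivor.aemeasurable f.continuous.aestronglyMeasurable, h, h0,
    OnePoint.measurableEmbedding_coe.integral_map, zero_mul, add_zero]

theorem IsSelfDual.invariant_branchingKernel :
    H.branchingKernel.Invariant (m.map ((↑) : D → OnePoint D)) := by
  rw [Kernel.Invariant, branchingKernel, ← Measure.map_comp _ _ H.measurable_survivor]
  exact hm.map_survivor_pairLawOf hfin

end SelfDual

end HuntProcess

/-! ### Trajectory measures with a finite initial law -/

namespace ProbabilityTheory.Kernel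

variable {E : Type*} [MeasurableSpace E] (κ : (n : ℕ) → Kernel (Finset.Iic n → E) E)
  [∀ n, IsMarkovKernel (κ n)] (μ : Measure E)

instance isFiniteMeasure_trajMeasure [IsFiniteMeasure μ] : IsFiniteMeasure (trajMeasure (X := fun _ => E) μ κ) := by
  have : IsFiniteMeasure (μ.map (MeasurableEquiv.piUnique fun _ : Finset.Iic 0 => E).symm) :=
    inferInstance
  exact inferInstanceAs (IsFiniteMeasure (traj (X := fun _ => E) κ 0 ∘ₘ
    μ.map (MeasurableEquiv.piUnique fun _ : Finset.Iic 0 => E).symm))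

theorem map_frestrictLe_trajMeasure_compProd [IsFiniteMeasure μ] (a : ℕ) :
    (trajMeasure (X := fun _ => E) μ κ).map (Preorder.frestrictLe a) ⊗ₘ κ a =
      (trajMeasure (X := fun _ => E) μ κ).map
        (fun x ↦ (Preorder.frestrictLe (π := fun _ => E) a x, x (a + 1))) := by
  rw [Measure.compProd_eq_comp_prod, trajMeasure, Measure.map_comp _ _ (by fun_prop),
    traj_map_frestrictLe, Measure.comp_assoc, Measure.map_comp _ _ (by fun_prop)]
  congr with x₀ : 1
  rw [comp_apply, ← Measure.compProd_eq_comp_prod, map_apply _ (by fun_prop),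
    partialTraj_compProd_eq_map_traj zero_le]

theorem map_eval_zero_trajMeasure :
    (trajMeasure (X := fun _ => E) μ κ).map (fun x => x 0) = μ := by
  have h : (fun x : ℕ → E => x 0) =
      MeasurableEquiv.piUnique (fun _ : Finset.Iic 0 => E) ∘
        Preorder.frestrictLe (π := fun _ => E) 0 := rfl
  rw [h, ← Measure.map_map (by fun_prop) (by fun_prop), trajMeasure,
    Measure.map_comp _ _ (by fun_prop), traj_map_frestrictLe, partialTraj_self, Measure.id_comp,
    Measure.map_map (by fun_prop) (by fun_prop), MeasurableEquiv.self_comp_symm, Measure.map_id]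

end ProbabilityTheory.Kernel

theorem IsMarkovChain.map_succ {Ω S : Type*} [MeasurableSpace Ω] [MeasurableSpace S]
    {μ : Measure Ω} {Z : ℕ → Ω → S} {Q : Kernel S S} (h : IsMarkovChain μ Z Q) (n : ℕ) :
    μ.map (Z (n + 1)) = (μ.map (Z n)).bind Q := by
  ext B hB
  have := h.2 n univ B MeasurableSet.univ hB
  rw [Measure.map_apply (h.1 _) hB, Measure.bind_apply hB (Kernel.aemeasurable _),
    lintegral_map (Kernel.measurable_coe _ hB) (h.1 n)]
  simp only [mem_univ, ofPred_true, univ_inter, Measure.restrict_univ] at this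
  exact this

/-! ### The branching positions form a Markov chain. -/

namespace HuntProcess

variable {D Ω : Type*} [TopologicalSpace D] [T2Space D] [LocallyCompactSpace D]
  [SecondCountableTopology D] [MeasurableSpace Ω] (H : HuntProcess D Ω)

theorem measurable_branchingPosition (n : ℕ) : Measurable (H.branchingPosition n) := by
  cases n with
  | zero => exact (H.measurable_X 0).comp (measurable_fst.comp (measurable_pi_apply 0))
  | succ n => exact H.measurable_survivor.comp (measurable_pi_apply n)

theorem ae_pairKernel_start (z : OnePoint D) : ∀ᵐ p ∂(H.pairKernel z), H.X 0 p.1 = z := by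
  rw [pairKernel, Kernel.comap_apply, Kernel.parallelComp_apply]
  exact Measure.quasiMeasurePreserving_fst.ae (H.start z)

section Markov

variable [MeasurableSpace D] (μ : Measure (D × D))

theorem map_eval_zero_flemingViot :
    (H.flemingViot μ).map (fun w => w 0) =
      (μ.map fun p => ((p.1 : OnePoint D), (p.2 : OnePoint D))).bind (H.P ∥ₖ H.P) :=
  Kernel.map_eval_zero_trajMeasure _ _

variable [IsFiniteMeasure μ]

instance : IsFiniteMeasure (H.flemingViot μ) := by
  unfold flemingViot; infer_instance

/-- The Markov property of the system: given the first `n + 1` excursions, the next branching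
position has law `branchingKernel` at the current branching position. -/
theorem flemingViot_inter_survivor (n : ℕ) {A : Set (Finset.Iic n → Ω × Ω)}
    {B : Set (OnePoint D)} (hA : MeasurableSet A) (hB : MeasurableSet B) :
    H.flemingViot μ ((fun w (i : Finset.Iic n) => w i) ⁻¹' A ∩
        {w | H.branchingPosition (n + 1 + 1) w ∈ B}) =
      ∫⁻ w in (fun w (i : Finset.Iic n) => w i) ⁻¹' A,
        H.branchingKernel (H.branchingPosition (n + 1) w) B ∂(H.flemingViot μ) := by
  have hB' := H.measurable_survivor hB
  have h := congrArg (fun ν => ν (A ×ˢ (H.survivor ⁻¹' B)))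
    (Kernel.map_frestrictLe_trajMeasure_compProd H.excursionKernel
      ((μ.map fun p => ((p.1 : OnePoint D), (p.2 : OnePoint D))).bind (H.P ∥ₖ H.P)) n)
  rw [Measure.compProd_apply_prod hA hB',
    setLIntegral_map hA (Kernel.measurable_coe _ hB') (by fun_prop),
    Measure.map_apply (by fun_prop) (hA.prod hB')] at h
  refine Eq.trans h.symm (lintegral_congr fun w => ?_)
  rw [branchingKernel, Kernel.map_apply' _ H.measurable_survivor _ hB, excursionKernel,
    Kernel.comap_apply]
  rfl

theorem isMarkovChain_branchingPosition_succ :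
    IsMarkovChain (H.flemingViot μ) (fun n => H.branchingPosition (n + 1)) H.branchingKernel := by
  refine ⟨fun n => H.measurable_branchingPosition _, fun n A B hA hB => ?_⟩
  have hS : Measurable fun (w : Finset.Iic n → Ω × Ω) i => H.survivor (w i) :=
    measurable_pi_lambda _ fun i => H.measurable_survivor.comp (measurable_pi_apply i)
  have hset : {w | (fun i : Finset.Iic n => H.branchingPosition (i + 1) w) ∈ A} =
      (fun (w : ℕ → Ω × Ω) (i : Finset.Iic n) => w i) ⁻¹'
        ((fun (w : Finset.Iic n → Ω × Ω) i => H.survivor (w i)) ⁻¹' A) := rfl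
  rw [hset]
  exact H.flemingViot_inter_survivor μ n (hS hA) hB

theorem map_eval_zero_flemingViot_diagonalMeasure [BorelSpace D] (ν : Measure D) :
    (H.flemingViot (diagonalMeasure ν)).map (fun w => w 0) = H.pairLawOf ν := by
  have hdiag : Measurable fun z : OnePoint D => (z, z) := measurable_id.prodMk measurable_id
  have hcoe : Measurable fun p : D × D => ((p.1 : OnePoint D), (p.2 : OnePoint D)) :=
    (OnePoint.measurable_coe_borel.comp measurable_fst).prodMk
      (OnePoint.measurable_coe_borel.comp measurable_snd)
  have h : (diagonalMeasure ν).map (fun p => ((p.1 : OnePoint D), (p.2 : OnePoint D))) =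
      (ν.map ((↑) : D → OnePoint D)).map fun z => (z, z) := by
    rw [diagonalMeasure, Measure.map_map hcoe (by fun_prop),
      Measure.map_map hdiag OnePoint.measurable_coe_borel]
    rfl
  rw [map_eval_zero_flemingViot, h, pairLawOf, pairKernel]
  ext B hB
  rw [Measure.bind_apply hB (Kernel.aemeasurable _), Measure.bind_apply hB (Kernel.aemeasurable _),
    lintegral_map (Kernel.measurable_coe _ hB) hdiag]
  rfl

theorem isMarkovChain_branchingPosition [BorelSpace D] (ν : Measure D) [IsFiniteMeasure ν] :
    IsMarkovChain (H.flemingViot (diagonalMeasure ν)) H.branchingPosition H.branchingKernel := by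
  have : IsFiniteMeasure (diagonalMeasure ν) := by unfold diagonalMeasure; infer_instance
  refine ⟨H.measurable_branchingPosition, fun n A B hA hB => ?_⟩
  cases n with
  | zero =>
    let A₀ : Set (OnePoint D) := (fun z (_ : Finset.Iic 0) => z) ⁻¹' A
    have hA₀ : MeasurableSet A₀ := (measurable_pi_lambda _ fun _ => measurable_id) hA
    let S : Set (Ω × Ω) := {p | H.X 0 p.1 ∈ A₀}
    have hS : MeasurableSet S := ((H.measurable_X 0).comp measurable_fst) hA₀
    have hSB : MeasurableSet (S ∩ H.survivor ⁻¹' B) := hS.inter (H.measurable_survivor hB)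
    have hQ : Measurable fun p : Ω × Ω => H.branchingKernel (H.X 0 p.1) B :=
      (Kernel.measurable_coe _ hB).comp ((H.measurable_X 0).comp measurable_fst)
    have heval : Measurable fun w : ℕ → Ω × Ω => w 0 := measurable_pi_apply 0
    have hset : {w | (fun i : Finset.Iic 0 => H.branchingPosition i w) ∈ A} =
        (fun w : ℕ → Ω × Ω => w 0) ⁻¹' S := by
      ext w
      have : (fun i : Finset.Iic 0 => H.branchingPosition i w) = fun _ => H.X 0 (w 0).1 := by
        funext ⟨i, hi⟩
        obtain rfl : i = 0 := by simpa using hi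
        rfl
      rw [mem_ofPred_eq, this]
      rfl
    have hL : H.flemingViot (diagonalMeasure ν) ((fun w : ℕ → Ω × Ω => w 0) ⁻¹' S ∩
        {w | H.branchingPosition (0 + 1) w ∈ B}) = H.pairLawOf ν (S ∩ H.survivor ⁻¹' B) := by
      rw [← map_eval_zero_flemingViot_diagonalMeasure, Measure.map_apply heval hSB]
      rfl
    have hR : ∫⁻ w in (fun w : ℕ → Ω × Ω => w 0) ⁻¹' S,
        H.branchingKernel (H.branchingPosition 0 w) B ∂(H.flemingViot (diagonalMeasure ν)) =
        ∫⁻ p in S, H.branchingKernel (H.X 0 p.1) B ∂(H.pairLawOf ν) := by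
      rw [← map_eval_zero_flemingViot_diagonalMeasure, setLIntegral_map hS hQ heval]
      rfl
    rw [hset, hL, hR, ← lintegral_indicator hS, pairLawOf,
      Measure.bind_apply hSB (Kernel.aemeasurable _),
      Measure.lintegral_bind (Kernel.aemeasurable _) (hQ.indicator hS).aemeasurable]
    -- Given the common starting point `z`, the event on `Z_0` is almost surely decided by `z`, so
    -- it either drops out or kills both sides.
    refine lintegral_congr fun z => ?_
    by_cases hz : z ∈ A₀
    · have h1 : H.pairKernel z (S ∩ H.survivor ⁻¹' B) = H.branchingKernel z B := by
        rw [branchingKernel, Kernel.map_apply' _ H.measurable_survivor _ hB]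
        refine measure_congr ?_
        filter_upwards [H.ae_pairKernel_start z] with p hp
        exact propext (and_iff_right (show H.X 0 p.1 ∈ A₀ by rwa [hp]))
      have h2 : ∫⁻ p, S.indicator (fun p => H.branchingKernel (H.X 0 p.1) B) p ∂(H.pairKernel z) =
          ∫⁻ _, H.branchingKernel z B ∂(H.pairKernel z) := by
        refine lintegral_congr_ae ?_
        filter_upwards [H.ae_pairKernel_start z] with p hp
        rw [indicator_of_mem (show p ∈ S from show H.X 0 p.1 ∈ A₀ by rwa [hp]), hp]
      rw [h1, h2, lintegral_const, measure_univ, mul_one]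
    · have h1 : ∀ᵐ p ∂(H.pairKernel z), p ∉ S := by
        filter_upwards [H.ae_pairKernel_start z] with p hp
        exact fun h => hz (by rw [← hp]; exact h)
      rw [measure_mono_null inter_subset_left (by simpa [ae_iff] using h1),
        lintegral_eq_zero_of_ae_eq_zero]
      filter_upwards [h1] with p hp using indicator_of_notMem hp _
  | succ n =>
    -- `F` reads `Z_0, …, Z_{n+1}` off the excursions `0, …, n`: `Z_0` from the start of excursion
    -- `0`, and `Z_i` from the end of excursion `i - 1`.
    let F : (Finset.Iic n → Ω × Ω) → Finset.Iic (n + 1) → OnePoint D := fun w i =>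
      if h : i.1 = 0 then H.X 0 (w ⟨0, Finset.mem_Iic.2 zero_le⟩).1
      else H.survivor (w ⟨i.1 - 1, Finset.mem_Iic.2 (by have := Finset.mem_Iic.1 i.2; omega)⟩)
    have hF : Measurable F := by
      refine measurable_pi_lambda _ fun i => ?_
      by_cases h : i.1 = 0
      · simp only [F, h, dite_true]
        exact (H.measurable_X 0).comp (measurable_fst.comp (measurable_pi_apply _))
      · simp only [F, h, dite_false]
        exact H.measurable_survivor.comp (measurable_pi_apply _)
    have hZ : ∀ w : ℕ → Ω × Ω, (fun i : Finset.Iic (n + 1) => H.branchingPosition i w) =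
        F fun i => w i := by
      intro w
      funext ⟨i, hi⟩
      cases i with
      | zero => simp [F, branchingPosition]
      | succ i => simp [F, branchingPosition]
    have hset : {w | (fun i : Finset.Iic (n + 1) => H.branchingPosition i w) ∈ A} =
        (fun (w : ℕ → Ω × Ω) (i : Finset.Iic n) => w i) ⁻¹' (F ⁻¹' A) := by
      ext w
      rw [mem_ofPred_eq, hZ]
      rfl
    rw [hset]
    exact H.flemingViot_inter_survivor _ n (hF hA) hB

end Markov

end HuntProcess

/-! ### Finite lifetimes, absolute continuity and conservativeness. -/

namespace HuntProcess

variable {D Ω : Type*} [TopologicalSpace D] [T2Space D] [LocallyCompactSpace D]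
  [SecondCountableTopology D] [MeasurableSpace Ω] (H : HuntProcess D Ω)
  [MeasurableSpace D] [BorelSpace D]

theorem map_branchingPosition_zero (ν : Measure D) :
    (H.flemingViot (diagonalMeasure ν)).map (H.branchingPosition 0) =
      ν.map ((↑) : D → OnePoint D) := by
  have hX : Measurable fun p : Ω × Ω => H.X 0 p.1 := (H.measurable_X 0).comp measurable_fst
  have h : H.branchingPosition 0 = (fun p : Ω × Ω => H.X 0 p.1) ∘ fun w => w 0 := rfl
  rw [h, ← Measure.map_map hX (measurable_pi_apply 0), map_eval_zero_flemingViot_diagonalMeasure]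
  ext B hB
  rw [Measure.map_apply hX hB, pairLawOf, Measure.bind_apply (hX hB) (Kernel.aemeasurable _),
    ← lintegral_indicator_one hB]
  refine lintegral_congr fun z => ?_
  by_cases hz : z ∈ B
  · rw [indicator_of_mem hz, Pi.one_apply, ← prob_compl_eq_zero_iff (hX hB)]
    refine measure_mono_null ?_ (H.ae_pairKernel_start z)
    intro p hp h
    exact hp (by rw [mem_preimage, h]; exact hz)
  · rw [indicator_of_notMem hz]
    refine measure_mono_null ?_ (H.ae_pairKernel_start z)
    intro p hp h
    exact hz (by rw [← h]; exact hp)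

/-- If two independent copies started at a common point almost surely do not both have lifetime
`t`, then the lifetime of one copy almost surely differs from `t`. -/
theorem ae_lawOf_lifetime_ne {m : Measure D} {t : ℝ≥0∞}
    (h : ∀ᵐ p ∂(H.pairLawOf m), ¬ (H.lifetime p.1 = t ∧ H.lifetime p.2 = t)) :
    ∀ᵐ ω ∂(H.lawOf m), H.lifetime ω ≠ t := by
  have hm1 : MeasurableSet {ω | H.lifetime ω = t} :=
    H.measurable_lifetime (measurableSet_singleton t)
  refine (H.ae_lawOf_iff hm1.compl).2 ?_
  have hm2 : MeasurableSet {p : Ω × Ω | ¬ (H.lifetime p.1 = t ∧ H.lifetime p.2 = t)} :=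
    (hm1.prod hm1).compl
  filter_upwards [(H.ae_pairLawOf_iff hm2).1 h] with x hx
  -- By independence given `x`, this is the square of the probability that one copy has lifetime
  -- `t`.
  have h0 : ((H.P (x : OnePoint D)).prod (H.P (x : OnePoint D)))
      ({ω | H.lifetime ω = t} ×ˢ {ω | H.lifetime ω = t}) = 0 := by
    rw [ae_iff] at hx
    simp only [not_not] at hx
    exact hx
  rw [Measure.prod_prod, mul_self_eq_zero] at h0
  rw [ae_iff]
  simpa only [ne_eq, not_not] using h0

theorem map_eval_zero_flemingViot_prod (m : Measure D) [IsFiniteMeasure m] :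
    (H.flemingViot (m.prod m)).map (fun w => w 0) = (H.lawOf m).prod (H.lawOf m) := by
  have h : ((m.prod m).map fun p => ((p.1 : OnePoint D), (p.2 : OnePoint D))) =
      (m.map ((↑) : D → OnePoint D)).prod (m.map ((↑) : D → OnePoint D)) :=
    (Measure.map_prod_map _ _ OnePoint.measurable_coe_borel OnePoint.measurable_coe_borel).symm
  rw [map_eval_zero_flemingViot, h, lawOf, Measure.prod_comp_right, Measure.prod_comp_left,
    Measure.comp_assoc, Kernel.parallelComp_comp_parallelComp, Kernel.id_comp, Kernel.comp_id]

/-- Finiteness of `τ_1` says only that one of the two particles dies. Independence from a common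
starting point upgrades this to each of them. -/
theorem ae_lifetime_lt_top_of_branchingTime {m : Measure D}
    (hτ : ∀ᵐ w ∂(H.flemingViot (diagonalMeasure m)), ∀ n, H.branchingTime n w < ⊤) :
    ∀ᵐ ω ∂(H.lawOf m), H.lifetime ω < ⊤ := by
  suffices h : ∀ᵐ ω ∂(H.lawOf m), H.lifetime ω ≠ ⊤ by
    filter_upwards [h] with ω hω using hω.lt_top
  refine H.ae_lawOf_lifetime_ne ?_
  have hm1 : MeasurableSet {ω | H.lifetime ω = ⊤} :=
    H.measurable_lifetime (measurableSet_singleton ⊤)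
  have heval : Measurable fun w : ℕ → Ω × Ω => w 0 := measurable_pi_apply 0
  rw [← map_eval_zero_flemingViot_diagonalMeasure]
  refine (ae_map_iff heval.aemeasurable (hm1.prod hm1).compl).2 ?_
  filter_upwards [hτ] with w hw
  rintro ⟨h1, h2⟩
  have := hw 1
  simp [branchingTime, firstDeath, show H.lifetime (w 0).1 = ⊤ from h1,
    show H.lifetime (w 0).2 = ⊤ from h2] at this

section SelfDual

variable {H}
variable {m : Measure D} [IsFiniteMeasure m] (hm : H.IsSelfDual m)

include hm

/-- At a fixed time, a self-dual process started from `m` avoids the `m`-null sets. -/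
theorem IsSelfDual.lawOf_X_mem_eq_zero {N : Set (OnePoint D)} (hN : MeasurableSet N)
    (hN0 : m.map ((↑) : D → OnePoint D) N = 0) (t : ℝ≥0) :
    H.lawOf m {ω | H.X t ω ∈ N ∧ H.X t ω ≠ OnePoint.infty} = 0 := by
  have hN' : MeasurableSet (((↑) : D → OnePoint D) ⁻¹' N) := OnePoint.measurable_coe_borel hN
  rw [Measure.map_apply OnePoint.measurable_coe_borel hN] at hN0
  set g : D → ℝ := indicator (((↑) : D → OnePoint D) ⁻¹' N) 1 with hg_def
  have hg : Measurable g := measurable_one.indicator hN'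
  have hg0 : ∀ x, 0 ≤ g x := indicator_nonneg fun _ _ => zero_le_one
  have hg1 : ∀ x, |g x| ≤ 1 := fun x => by
    rw [abs_of_nonneg (hg0 x)]
    exact indicator_le_self' (fun _ _ => zero_le_one) x
  have hgae : g =ᵐ[m] 0 := indicator_meas_zero hN0
  have h1 : ∫ ω, (H.X t ω).elim 0 g ∂(H.lawOf m) = 0 := by
    rw [← H.integral_transitionOp_eq_integral_lawOf t hg zero_le_one hg1]
    -- Duality against `1`: `∫ P_t g dm = ∫ g · P_t 1 dm`, which vanishes with `g`.
    have := hm t g 1 hg measurable_one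
      (MemLp.of_bound hg.aestronglyMeasurable 1 (ae_of_all _ hg1)) (memLp_const 1)
    simp only [Pi.one_apply, mul_one] at this
    rw [this]
    refine integral_eq_zero_of_ae ?_
    filter_upwards [hgae] with x hx
    simp [hx]
  rw [integral_eq_zero_iff_of_nonneg (fun ω => ?_) (Integrable.of_bound
    (H.measurable_elim_X t hg).aestronglyMeasurable 1
    (ae_of_all _ fun ω => OnePoint.abs_elim_zero_le zero_le_one hg1 _))] at h1
  · refine measure_mono_null ?_ h1
    rintro ω ⟨hω, hω'⟩ h
    obtain ⟨y, hy⟩ := OnePoint.ne_infty_iff_exists.1 hω'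
    rw [← hy] at hω
    have h' : (H.X t ω).elim 0 g = 0 := h
    rw [← hy, OnePoint.elim_some, hg_def, indicator_of_mem (by exact hω)] at h'
    exact one_ne_zero h'
  · simp only [Pi.zero_apply]
    rcases eq_or_ne (H.X t ω) OnePoint.infty with h | h
    · rw [h]; exact le_rfl
    · obtain ⟨y, hy⟩ := OnePoint.ne_infty_iff_exists.1 h
      rw [← hy]; exact hg0 y

variable (hfin : ∀ᵐ ω ∂(H.lawOf m), H.lifetime ω < ⊤)

include hfin

/-- The lifetime of one particle is independent of the other path, so it acts as a fixed time, at
which the other particle avoids `m`-null sets of `D`. Ties are null because the lifetime has no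
atoms under `lawOf m`: an atom would produce ties from the diagonal. -/
theorem IsSelfDual.map_survivor_absolutelyContinuous :
    ((H.lawOf m).prod (H.lawOf m)).map H.survivor ≪ m.map ((↑) : D → OnePoint D) := by
  refine Measure.AbsolutelyContinuous.mk fun N hN hN0 => ?_
  rw [Measure.map_apply H.measurable_survivor hN]
  have hne : ∀ t, ∀ᵐ ω ∂(H.lawOf m), H.lifetime ω ≠ t := fun t => by
    refine H.ae_lawOf_lifetime_ne (measure_mono_null ?_ (hm.pairLawOf_lifetime_eq hfin))
    intro p hp
    obtain ⟨h1, h2⟩ := not_not.1 hp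
    exact h1.trans h2.symm
  have hN1 : MeasurableSet (N ∩ {OnePoint.infty}ᶜ) := hN.inter (measurableSet_singleton _).compl
  let S : Set (Ω × Ω) := {p | H.X (H.lifetime p.1).toNNReal p.2 ∈ N ∩ {OnePoint.infty}ᶜ}
  have hS : MeasurableSet S := (H.measurable_X_comp
    (H.measurable_lifetime.comp measurable_fst).ennreal_toNNReal measurable_snd) hN1
  -- Fubini with the first path frozen. An infinite lifetime is read as time `0`, which is harmless
  -- since the estimate holds at every fixed time.
  have hS0 : (H.lawOf m).prod (H.lawOf m) S = 0 :=
    (Measure.measure_prod_null hS).2 (ae_of_all _ fun ω =>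
      measure_mono_null (fun _ h => h) (hm.lawOf_X_mem_eq_zero hN hN0 (H.lifetime ω).toNNReal))
  have hS0' : (H.lawOf m).prod (H.lawOf m) (Prod.swap ⁻¹' S) = 0 := by
    rw [Measure.measurePreserving_swap.measure_preimage hS.nullMeasurableSet, hS0]
  have heq : (H.lawOf m).prod (H.lawOf m) {p | H.lifetime p.1 = H.lifetime p.2} = 0 := by
    refine (Measure.measure_prod_null H.measurableSet_lifetime_eq).2 (ae_of_all _ fun ω => ?_)
    refine measure_mono_null ?_ (hne (H.lifetime ω))
    intro ω' (h : H.lifetime ω = H.lifetime ω') h'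
    exact h' h.symm
  refine measure_mono_null ?_ (measure_union_null (measure_union_null hS0 hS0') heq)
  intro p (hp : H.survivor p ∈ N)
  rw [survivor] at hp
  rcases lt_trichotomy (H.lifetime p.1) (H.lifetime p.2) with h | h | h
  · rw [if_neg h.not_gt, if_pos h] at hp
    have hS : p ∈ S := ⟨hp, ((H.X_lifetime_ne_infty_iff _ _).1 h).2⟩
    exact Or.inl (Or.inl hS)
  · exact Or.inr h
  · rw [if_pos h] at hp
    have hS : p.swap ∈ S := ⟨hp, ((H.X_lifetime_ne_infty_iff _ _).1 h).2⟩
    exact Or.inl (Or.inr hS)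

theorem IsSelfDual.map_branchingPosition_diagonal (n : ℕ) :
    (H.flemingViot (diagonalMeasure m)).map (H.branchingPosition n) =
      m.map ((↑) : D → OnePoint D) := by
  induction n with
  | zero => exact H.map_branchingPosition_zero m
  | succ n ih =>
    rw [(H.isMarkovChain_branchingPosition m).map_succ n, ih]
    exact hm.invariant_branchingKernel hfin

theorem IsSelfDual.map_branchingPosition_prod_absolutelyContinuous (n : ℕ) :
    (H.flemingViot (m.prod m)).map (H.branchingPosition (n + 1)) ≪
      m.map ((↑) : D → OnePoint D) := by
  induction n with
  | zero =>
    have h : H.branchingPosition (0 + 1) = H.survivor ∘ fun w : ℕ → Ω × Ω => w 0 := rfl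
    rw [h, ← Measure.map_map H.measurable_survivor (measurable_pi_apply 0),
      map_eval_zero_flemingViot_prod]
    exact hm.map_survivor_absolutelyContinuous hfin
  | succ n ih =>
    rw [(H.isMarkovChain_branchingPosition_succ (m.prod m)).map_succ n]
    -- One step of the kernel preserves absolute continuity and sends `m` to itself.
    have h := ih.comp_right H.branchingKernel
    rwa [hm.invariant_branchingKernel hfin] at h

end SelfDual

theorem ae_branchingPosition_ne_infty {m : Measure D} {μ : Measure (D × D)} {n : ℕ}
    (h : (H.flemingViot μ).map (H.branchingPosition n) ≪ m.map ((↑) : D → OnePoint D)) :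
    ∀ᵐ w ∂(H.flemingViot μ), H.branchingPosition n w ≠ OnePoint.infty := by
  have h1 : ∀ᵐ z ∂(m.map ((↑) : D → OnePoint D)), z ≠ OnePoint.infty :=
    (OnePoint.measurableEmbedding_coe.ae_map_iff).2 (ae_of_all _ fun x => OnePoint.coe_ne_infty x)
  exact ae_of_ae_map (H.measurable_branchingPosition n).aemeasurable (h.ae_le h1)

end HuntProcess

theorem corollary1p4 {D Ω : Type*} [TopologicalSpace D] [T2Space D] [LocallyCompactSpace D]
    [SecondCountableTopology D] [MeasurableSpace D] [BorelSpace D] [MeasurableSpace Ω]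
    (H : HuntProcess D Ω) (m : Measure D) [IsFiniteMeasure m] (hm : H.IsSelfDual m)
    (hτ : ∀ᵐ w ∂(H.flemingViot (diagonalMeasure m)), ∀ n, H.branchingTime n w < ⊤) :
    -- `Z_n` is a Markov chain, for every initial configuration of the two particles
    (∀ μ : Measure (D × D), IsFiniteMeasure μ →
      IsMarkovChain (H.flemingViot μ) (fun n => H.branchingPosition (n + 1)) H.branchingKernel) ∧
    (∀ ν : Measure D, IsFiniteMeasure ν →
      IsMarkovChain (H.flemingViot (diagonalMeasure ν)) H.branchingPosition H.branchingKernel) ∧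
    -- it is conservative: for almost every initial configuration, it never leaves `D`
    (∀ᵐ w ∂(H.flemingViot (diagonalMeasure m)), ∀ n, H.branchingPosition n w ≠ OnePoint.infty) ∧
    (∀ᵐ w ∂(H.flemingViot (m.prod m)), ∀ n, H.branchingPosition (n + 1) w ≠ OnePoint.infty) ∧
    -- `m` is a stationary measure
    H.branchingKernel.Invariant (m.map ((↑) : D → OnePoint D)) ∧
    (∀ n, (H.flemingViot (diagonalMeasure m)).map (H.branchingPosition n) =
      m.map ((↑) : D → OnePoint D)) := by
  have hfin := H.ae_lifetime_lt_top_of_branchingTime hτ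
  refine ⟨fun μ _ => H.isMarkovChain_branchingPosition_succ μ,
    fun ν _ => H.isMarkovChain_branchingPosition ν, ?_, ?_, hm.invariant_branchingKernel hfin,
    hm.map_branchingPosition_diagonal hfin⟩
  · exact ae_all_iff.2 fun n => H.ae_branchingPosition_ne_infty
      (hm.map_branchingPosition_diagonal hfin n).absolutelyContinuous
  · exact ae_all_iff.2 fun n => H.ae_branchingPosition_ne_infty
      (hm.map_branchingPosition_prod_absolutelyContinuous hfin n)
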